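/- **Setting.** Let $K$ be a field of characteristic $0$, let $H$ be a finite-dimensional $K$-vector space with a symmetric non-degenerate bilinear form $(\cdot,\cdot)$ and a distinguished non-zero element $\mathbf 1$. Fix a basis $\{\phi_\alpha\}$ of $H$ with $\phi_1=\mathbf 1$, put $g_{\alpha\beta}=(\phi_\alpha,\phi_\beta)$, $(g^{\alpha\beta})=(g_{\alpha\beta})^{-1}$. Let $\mathcal F(\mathbf t)$ be a formal power series over $K$ in the coordinates $t_k^\alpha$ of the vector variables $t_k=\sum_\alpha t_k^\alpha\phi_\alpha\in H$, $k=0,1,2,\dots$, and write $\partial_{\alpha,k}=\partial/\partial t_k^\alpha$. Consider the equations $$\text{(DE)}\quad \partial_{1,1}\mathcal F=\sum_{n\ge 0}\sum_\nu t_n^\nu\,\partial_{\nu,n}\mathcal F-2\mathcal F,$$ $$\text{(SE)}\quad \partial_{1,0}\mathcal F=\tfrac12(t_0,t_0)+\sum_{n\ge 0}\sum_\nu t_{n+1}^\nu\,\partial_{\nu,n}\mathcal F,$$ $$\text{(TRR)}\quad \partial_{\alpha,k+1}\partial_{\beta,l}\partial_{\gamma,m}\mathcal F=\sum_{\mu,\nu}\bigl(\partial_{\alpha,k}\partial_{\mu,0}\mathcal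 F\bigr)\,g^{\mu\nu}\,\bigl(\partial_{\nu,0}\partial_{\beta,l}\partial_{\gamma,m}\mathcal F\bigr)\quad\text{for all }\alpha,\beta,\gamma\text{ and all }k,l,m\ge 0.$$ Let $\mathcal H=H((z^{-1}))$ with the symplectic form $\Omega(\mathbf f,\mathbf g)=\frac1{2\pi i}\oint(\mathbf f(-z),\mathbf g(z))\,dz$ (the coefficient of $z^{-1}$). The polarization $\mathcal H=\mathcal H_+\oplus\mathcal H_-$, $\mathcal H_+=H[z]$, $\mathcal H_-=z^{-1}H[[z^{-1}]]$, identifies $\mathcal H$ with $T^*\mathcal H_+$: a point $\mathbf q+\mathbf p$ corresponds to the covector $\Omega(\mathbf p,\cdot)|_{\mathcal H_+}$ at $\mathbf q$. By the dilaton shift $\mathbf q(z)=-\mathbf 1z+t_0+t_1z+t_2z^2+\cdots$, $\mathcal F$ is a formal function on $\mathcal H_+$ near $\mathbf q=-\mathbf 1z$. Let $\mathcal L=\{(\mathbf p,\mathbf q):\mathbf p=d_{\mathbf q}\mathcal F\}\subset\mathcal H$ be the graph of its differential, a formal germ at the point $\mathbf f_0$ of $\mathcal L$ over $\mathbf q=-\mathbf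 1z$. Everything below is understood in the sense of formal geometry near $\mathbf f_0$: points are points with values in an arbitrary commutative $K$-algebra $R$ whose coordinates differ from those of $\mathbf f_0$ by nilpotents, and $T_{\mathbf f}\mathcal L$ is the graph of the second differential of $\mathcal F$ at $\mathbf f$. Property $(\star)$: *$\mathcal L$ is a Lagrangian cone with the vertex at the origin and such that its tangent spaces $L$ are tangent to $\mathcal L$ exactly along $zL$.* That is, for each point $\mathbf f$ of $\mathcal L$ the tangent space $L=T_{\mathbf f}\mathcal L$ equals its $\Omega$-orthogonal complement; $c\,\mathbf f\in\mathcal L$ for all scalars $c$ with $c-1$ nilpotent; $zL\subset L$; and a point $\mathbf g$ near $\mathbf f_0$ lies in $zL$ if and only if $\mathbf g\in\mathcal L$ and $T_{\mathbf g}\mathcal L=L$ (in particular, $\mathbf f\in zL$). **Theorem 1.** $\mathcal F$ satisfies TRR, SE and DE if and only if $\mathcal L$ has the property $(\star)$ and the additive constant of $\mathcal F$, which $\mathcal L$ does not determine, is normalized by $2\mathcal F(0)=-(\partial_{1,1}\mathcal F)(0)$, i.e. $\mathcal F=\tfrac12\mathbf p(\mathbf q)$ at the base point $\mathbf f_0$.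 -/

import Mathlib

open scoped TensorProduct

noncomputable section

namespace GenusZero

universe u v w

/-! ### Formal functions of the variables `t_k^α`

A formal function of `t = (t_0, t_1, …)`, `t_k = ∑_α t_k^α φ_α ∈ H`, is a formal power series in the
variables `t_k^α`, which are indexed by the pairs `(k, α) : ℕ × ι`. -/

section Axioms

variable {K : Type u} [Field K] {ι : Type w}

/-- Coefficientwise sum of a (locally finite) family of formal power series. -/
def formalSum {σ κ : Type*} (f : κ → MvPowerSeries σ K) : MvPowerSeries σ K :=
  fun m => ∑ᶠ j, MvPowerSeries.coeff m (f j)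

/-- The families summed below, `(t_{a j} G_j)_j` with distinct variables `t_{a j}`, are locally
finite, so that each coefficient of their sum is a finite sum. -/
theorem formalSum_support_finite {σ κ : Type*} (a : κ → σ) (ha : Function.Injective a)
    (G : κ → MvPowerSeries σ K) (m : σ →₀ ℕ) :
    (Function.support fun j =>
      MvPowerSeries.coeff m (MvPowerSeries.X (a j) * G j)).Finite := by
  classical
  refine Set.Finite.subset (m.support.finite_toSet.preimage ha.injOn) ?_
  intro j hj
  simp only [Set.mem_preimage, Finset.mem_coe, Finsupp.mem_support_iff]
  intro h0
  apply hj
  have hX : (MvPowerSeries.X (a j) : MvPowerSeries σ K) =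
      MvPowerSeries.monomial (Finsupp.single (a j) 1) 1 := rfl
  simp only [hX, MvPowerSeries.coeff_monomial_mul]
  rw [if_neg]
  intro hle
  have := hle (a j)
  simp [h0] at this

variable {H : Type v} [AddCommGroup H] [Module K H]

/-- The partial derivative `∂_{α,k} = ∂/∂t_k^α`, where `i = (k, α)`. -/
abbrev del (i : ℕ × ι) (F : MvPowerSeries (ℕ × ι) K) : MvPowerSeries (ℕ × ι) K :=
  MvPowerSeries.pderiv K i F

/-- The dilaton equation `∂_{1,1} F = ∑_{n,ν} t_n^ν ∂_{ν,n} F - 2 F`. -/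
def DilatonEquation (e : ι) (F : MvPowerSeries (ℕ × ι) K) : Prop :=
  del (1, e) F = formalSum (fun j : ℕ × ι => MvPowerSeries.X j * del j F) - 2 * F

/-- The string equation `∂_{1,0} F = (t_0, t_0) / 2 + ∑_{n,ν} t_{n+1}^ν ∂_{ν,n} F`. -/
def StringEquation [Fintype ι] (B : LinearMap.BilinForm K H) (φ : Module.Basis ι K H) (e : ι)
    (F : MvPowerSeries (ℕ × ι) K) : Prop :=
  del (0, e) F =
    (2⁻¹ : K) • (∑ α, ∑ β, B (φ α) (φ β) •
      (MvPowerSeries.X ((0, α) : ℕ × ι) * MvPowerSeries.X ((0, β) : ℕ × ι))) +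
    formalSum (fun j : ℕ × ι => MvPowerSeries.X (j.1 + 1, j.2) * del j F)

/-- The topological recursion relations
`∂_{α,k+1} ∂_{β,l} ∂_{γ,m} F = ∑_{μ,ν} (∂_{α,k} ∂_{μ,0} F) g^{μν} (∂_{ν,0} ∂_{β,l} ∂_{γ,m} F)`. -/
def TopologicalRecursionRelations [Fintype ι] [DecidableEq ι] (B : LinearMap.BilinForm K H)
    (φ : Module.Basis ι K H) (F : MvPowerSeries (ℕ × ι) K) : Prop :=
  ∀ (α β γ : ι) (k l m : ℕ),
    del (k + 1, α) (del (l, β) (del (m, γ) F)) =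
      ∑ μ, ∑ ν, ((Matrix.of fun a b => B (φ a) (φ b))⁻¹ μ ν) •
        (del (k, α) (del (0, μ) F) * del (0, ν) (del (l, β) (del (m, γ) F)))

/-- The additive constant of `F` is fixed by requiring that `F` equals half the evaluation of the
covector `p = dF` on the vector `q` at the base point `q = -z`, `t = 0`: there
`p(q) = -(∂_{1,1} F)(0)`. (The graph of `dF` does not see the additive constant of `F`.) -/
def ConstantNormalized (e : ι) (F : MvPowerSeries (ℕ × ι) K) : Prop :=
  2 * MvPowerSeries.constantCoeff F = - MvPowerSeries.constantCoeff (del (1, e) F)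

end Axioms

/-! ### Evaluation of formal functions at nilpotent points -/

section Evaluation

variable {K : Type u} [Field K] {R : Type*} [CommRing R] [Algebra K R] {σ : Type*}

/-- The value `∑_m (coeff m G) t^m` of a formal function at a point `t` that has finitely many
non-zero coordinates, all of them nilpotent. -/
def evalAt (G : MvPowerSeries σ K) (t : σ → R) : R :=
  ∑ᶠ m : σ →₀ ℕ, MvPowerSeries.coeff m G • m.prod fun i n => t i ^ n

/-- At such points, the sum that defines the value is finite. -/
theorem evalAt_support_finite (G : MvPowerSeries σ K) (t : σ → R)
    (hfin : (Function.support t).Finite) (hnil : ∀ i, IsNilpotent (t i)) :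
    (Function.support fun m : σ →₀ ℕ =>
      MvPowerSeries.coeff m G • m.prod fun i n => t i ^ n).Finite := by
  classical
  choose N hN using hnil
  refine Set.Finite.subset (hfin.toFinset.finsupp fun i => Finset.range (N i + 1)).finite_toSet ?_
  intro m hm
  have key : ∀ i ∈ m.support, t i ^ m i ≠ 0 := by
    intro i hi h0
    exact hm (by
      change _ • m.prod (fun i n => t i ^ n) = 0
      rw [Finsupp.prod, Finset.prod_eq_zero hi h0, smul_zero])
  rw [Finset.mem_coe, Finset.mem_finsupp_iff]
  refine ⟨fun i hi => ?_, fun i hi => ?_⟩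
  · rw [Set.Finite.mem_toFinset, Function.mem_support]
    intro h0
    have := key i hi
    rw [h0, zero_pow (Finsupp.mem_support_iff.mp hi)] at this
    exact this rfl
  · rw [Finset.mem_range]
    by_contra hlt
    by_cases hi' : i ∈ m.support
    · exact key i hi' (pow_eq_zero_of_le (by omega) (hN i))
    · rw [Finsupp.notMem_support_iff] at hi'
      omega

end Evaluation

/-! ### The symplectic loop space -/

section LoopSpace

variable (K : Type u) [Field K] (H : Type v) [AddCommGroup H] [Module K H]
  (R : Type u) [CommRing R] [Algebra K R]

/-- The loop space `H_R((z⁻¹))` with `H_R = R ⊗ H`: Laurent series in `z⁻¹`. The value `f n` is the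
coefficient of `z ^ n`; it vanishes for all large `n`. -/
def LoopSpace : Submodule R (ℤ → R ⊗[K] H) where
  carrier := {f | ∃ N : ℤ, ∀ n, N < n → f n = 0}
  add_mem' := by
    rintro f g ⟨N, hN⟩ ⟨M, hM⟩
    refine ⟨max N M, fun n hn => ?_⟩
    rw [Pi.add_apply, hN n ((le_max_left _ _).trans_lt hn),
      hM n ((le_max_right _ _).trans_lt hn), add_zero]
  zero_mem' := ⟨0, fun _ _ => rfl⟩
  smul_mem' := by
    rintro c f ⟨N, hN⟩
    exact ⟨N, fun n hn => by rw [Pi.smul_apply, hN n hn, smul_zero]⟩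

variable {K H R}

/-- Multiplication by `z`. -/
def mulZ (f : LoopSpace K H R) : LoopSpace K H R :=
  ⟨fun n => f.1 (n - 1), by
    obtain ⟨N, hN⟩ := f.2
    exact ⟨N + 1, fun n hn => hN (n - 1) (by omega)⟩⟩

/-- The projection to `z⁻¹ H_R[[z⁻¹]]` along `H_R[z]`. -/
def minusPart (f : LoopSpace K H R) : LoopSpace K H R :=
  ⟨fun n => if n < 0 then f.1 n else 0, ⟨0, fun n hn => if_neg (by omega)⟩⟩

/-- The element `x z ^ k`. -/
def monomialZ (k : ℕ) (x : R ⊗[K] H) : LoopSpace K H R :=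
  ⟨fun n => if n = k then x else 0, ⟨k, fun n hn => if_neg (by omega)⟩⟩

/-- The symplectic form `Ω(f, g) = (2πi)⁻¹ ∮ (f(-z), g(z)) dz`, that is, the coefficient
`∑_{i + j = -1} (-1)^i (f_i, g_j)` of `z⁻¹` in `(f(-z), g(z))`. -/
def Omega (B : LinearMap.BilinForm K H) (f g : LoopSpace K H R) : R :=
  ∑ᶠ i : ℤ, i.negOnePow • (B.baseChange R) (f.1 i) (g.1 (-1 - i))

/-- The sum in the symplectic form is finite. -/
theorem Omega_support_finite (B : LinearMap.BilinForm K H) (f g : LoopSpace K H R) :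
    (Function.support fun i : ℤ =>
      i.negOnePow • (B.baseChange R) (f.1 i) (g.1 (-1 - i))).Finite := by
  obtain ⟨N, hN⟩ := f.2
  obtain ⟨M, hM⟩ := g.2
  refine Set.Finite.subset (Set.finite_Icc (-1 - M) N) ?_
  intro i hi
  rw [Set.mem_Icc]
  by_contra hcon
  apply hi
  by_cases h : N < i
  · simp [hN i h]
  · simp [hM (-1 - i) (by omega)]

variable {ι : Type w} (B : LinearMap.BilinForm K H) (φ : Module.Basis ι K H) (e : ι)

/-- The coordinates `q_k^α` of the projection `q = ∑ q_k^α φ_α z ^ k` of `f` to `H_R[z]`. -/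
def qCoord (f : LoopSpace K H R) (i : ℕ × ι) : R :=
  (φ.baseChange R).repr (f.1 i.1) i.2

/-- The covector on `H_R[z]` that is given by the projection `p` of `f` to `z⁻¹ H_R[[z⁻¹]]` and the
symplectic form, evaluated on the basis vector `φ_α z ^ k`: the identification of the loop space
with the cotangent bundle of `H_R[z]`. -/
def pCoord (f : LoopSpace K H R) (i : ℕ × ι) : R :=
  Omega B (minusPart f) (monomialZ i.1 (φ.baseChange R i.2))

open Classical in
/-- The dilaton shift `q(z) = -z + t_0 + t_1 z + …`, where `-z` is `-𝟏 z` and `𝟏 = φ e`: the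
coordinates `t_k^α` of the projection of `f` to `H_R[z]`. -/
def tCoord (f : LoopSpace K H R) (i : ℕ × ι) : R :=
  qCoord φ f i + if i = (1, e) then 1 else 0

end LoopSpace

/-! ### The formal germ of the graph of `dF` and its tangent spaces

A formal germ is given by its points with values in the commutative `K`-algebras `R`: the points
whose coordinates differ from those of the base point by nilpotents. -/

section Cone

variable {K : Type u} [Field K] {H : Type v} [AddCommGroup H] [Module K H] {ι : Type w}
  (B : LinearMap.BilinForm K H) (φ : Module.Basis ι K H) (e : ι) (F : MvPowerSeries (ℕ × ι) K)

/-- The formal neighbourhood, in the loop space, of the base point: the point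
`q = -z`, `p = d_{-z} F`. -/
def formalNeighborhood (R : Type u) [CommRing R] [Algebra K R] : Set (LoopSpace K H R) :=
  {f | (∀ i, IsNilpotent (tCoord φ e f i)) ∧
    ∀ i, IsNilpotent
      (pCoord B φ f i - algebraMap K R (MvPowerSeries.constantCoeff (del i F)))}

/-- The formal germ at `q = -z` of the graph `{(p, q) | p = d_q F}`. -/
def graphOfDifferential (R : Type u) [CommRing R] [Algebra K R] : Set (LoopSpace K H R) :=
  {f | (∀ i, IsNilpotent (tCoord φ e f i)) ∧
    ∀ i, pCoord B φ f i = evalAt (del i F) (tCoord φ e f)}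

variable {R : Type u} [CommRing R] [Algebra K R]

/-- The tangent space at the point `f` of the graph: the solutions `h` of the linearization
`δp = (d²_q F)(δq)` of the equation `p = d_q F`. -/
def tangentSpace (f : LoopSpace K H R) : Set (LoopSpace K H R) :=
  {h | ∀ i, pCoord B φ h i =
    ∑ᶠ j, qCoord φ h j * evalAt (del j (del i F)) (tCoord φ e f)}

/-- A subset of the loop space is Lagrangian if it equals its orthogonal complement. -/
def IsLagrangianSet (L : Set (LoopSpace K H R)) : Prop :=
  ∀ h, h ∈ L ↔ ∀ h' ∈ L, Omega B h h' = 0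

/-- The property (⋆) of the formal germ of the graph of `dF`: it is a Lagrangian cone with the
vertex at the origin, and each of its tangent spaces `L` is tangent to it exactly along `z L`. The
germ lives near a point other than the origin, so that being a cone means to be invariant under
multiplication by scalars infinitesimally close to `1`. -/
def LagrangianConeProperty : Prop :=
  ∀ (R : Type u) [CommRing R] [Algebra K R],
    ∀ f ∈ graphOfDifferential B φ e F R,
      -- the tangent spaces are Lagrangian
      IsLagrangianSet B (tangentSpace B φ e F f) ∧
      -- the germ is a cone with the vertex at the origin
      (∀ c : R, IsNilpotent (c - 1) → c • f ∈ graphOfDifferential B φ e F R) ∧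
      -- the tangent space `L` at `f` satisfies `z L ⊆ L`
      mulZ '' tangentSpace B φ e F f ⊆ tangentSpace B φ e F f ∧
      -- the points `g` of `z L` are exactly the points of the germ with the tangent space `L`
      ∀ g ∈ formalNeighborhood B φ e F R,
        g ∈ mulZ '' tangentSpace B φ e F f ↔
          g ∈ graphOfDifferential B φ e F R ∧
            tangentSpace B φ e F g = tangentSpace B φ e F f

end Cone

end GenusZero

end

/-! At a point `f` of the graph let `L` be the tangent space, the graph of the Hessian of `F`; it is
Lagrangian because the Hessian is symmetric. The other conditions become identities for derivatives
of `F` at that point: `f ∈ L` is the dilaton equation differentiated once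
(`mem_tangentSpace_self_iff`), `f ∈ zL` is the string equation differentiated once
(`mem_mulZ_tangentSpace_self_iff`), and `zL ⊆ L` is a quadratic relation between second derivatives
(`mulZ_tangentSpace_subset_iff`). Nilpotent points separate power series
(`eq_zero_of_forall_evalAt_eq_zero`), so identities at all points are identities of series.

From the cone to the equations: the derivative of the quadratic relation is a sum of two TRR defects
(`del_twoPointDefect`). The defect is thus antisymmetric in its first two indices, while it is
symmetric in the last two, so it vanishes (`recursionDefect_eq_zero`). Property (⋆) with `g = f`
gives `f ∈ zL ⊆ L`, hence SE and DE up to constants. The constant of SE is found by comparing one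
derivative of SE with one of DE at the origin; that of DE is the normalization.

From the equations to the cone: by TRR the quadratic relation holds up to a constant, which SE and
TRR at the origin show to be zero (`twoPointDefect_eq_zero`). TRR also makes the second derivatives
of `F` constant along `f + zL`, so the first derivatives are affine there and `f + zL` stays on the
graph with the same tangent space (`evalAt_eq_of_add_mulZ`). By SE, `f ∈ zL`, so `f + zL = zL`,
which also contains every `c • f`; conversely `g` lies in `z` times its own tangent space. -/

namespace GenusZero

universe u v w

/-! ### Evaluation at nilpotent points and the chain rule -/

section Evaluation

variable {K : Type*} [Field K] {R : Type*} [CommRing R] [Algebra K R] {σ : Type*}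

/-- A point with finitely many non-zero coordinates, all of them nilpotent. -/
structure IsNilpotentPoint (t : σ → R) : Prop where
  finite_support : (Function.support t).Finite
  isNilpotent : ∀ i, IsNilpotent (t i)

theorem IsNilpotentPoint.finite_monomials {t : σ → R} (ht : IsNilpotentPoint t) :
    {m : σ →₀ ℕ | (m.prod fun i n => t i ^ n) ≠ 0}.Finite := by
  have key : (Function.support fun m : σ →₀ ℕ => m.prod fun i n => t i ^ n).Finite := by
    choose N hN using ht.isNilpotent
    refine Set.Finite.subset
      (ht.finite_support.toFinset.finsupp fun i => Finset.range (N i + 1)).finite_toSet ?_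
    intro m hm
    have key : ∀ i ∈ m.support, t i ^ m i ≠ 0 := fun i hi h0 => hm (Finset.prod_eq_zero hi h0)
    rw [Finset.mem_coe, Finset.mem_finsupp_iff]
    refine ⟨fun i hi => ?_, fun i hi => ?_⟩
    · rw [Set.Finite.mem_toFinset, Function.mem_support]
      intro h0
      have := key i hi
      rw [h0, zero_pow (Finsupp.mem_support_iff.mp hi)] at this
      exact this rfl
    · rw [Finset.mem_range]
      by_contra hlt
      by_cases hi' : i ∈ m.support
      · exact key i hi' (pow_eq_zero_of_le (by omega) (hN i))
      · rw [Finsupp.notMem_support_iff] at hi'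
        omega
  exact key

theorem IsNilpotentPoint.evalAt_eq_sum {t : σ → R} (ht : IsNilpotentPoint t)
    {S : Finset (σ →₀ ℕ)} (hS : ht.finite_monomials.toFinset ⊆ S) (G : MvPowerSeries σ K) :
    evalAt G t = ∑ m ∈ S, MvPowerSeries.coeff m G • m.prod fun i n => t i ^ n := by
  refine finsum_eq_sum_of_support_subset _ fun m hm => hS ?_
  rw [Set.Finite.mem_toFinset, Set.mem_ofPred_eq]
  intro h0
  exact hm (by simp [h0])

/-- For the discrete topologies on `K` and `R`, a nilpotent point of finite support is an admissible
substitution, so `evalAt` is the continuous substitution homomorphism and in particular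
multiplicative. -/
theorem IsNilpotentPoint.exists_algHom {t : σ → R} (ht : IsNilpotentPoint t) :
    ∃ ψ : MvPowerSeries σ K →ₐ[K] R, (∀ G, ψ G = evalAt G t) ∧
      ∀ p : MvPolynomial σ K, evalAt (p : MvPowerSeries σ K) t = MvPolynomial.aeval t p := by
  let _ : UniformSpace K := ⊥
  let _ : UniformSpace R := ⊥
  have : DiscreteUniformity K := ⟨rfl⟩
  have : DiscreteUniformity R := ⟨rfl⟩
  have : ContinuousSMul K R := ⟨continuous_of_discreteTopology⟩
  have ha : MvPowerSeries.HasEval t := by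
    refine ⟨fun i => ?_, ?_⟩
    · exact (ht.isNilpotent i).isTopologicallyNilpotent
    · rw [nhds_discrete, Filter.tendsto_pure]
      exact ht.finite_support.subset fun i hi => hi
  have key : ∀ G, MvPowerSeries.aeval (R := K) ha G = evalAt G t := fun G => by
    refine (MvPowerSeries.hasSum_aeval (R := K) ha G).unique ?_
    rw [ht.evalAt_eq_sum (Finset.Subset.refl _)]
    refine hasSum_sum_of_ne_finset_zero fun m hm => ?_
    have : (m.prod fun i n => t i ^ n) = 0 := by simpa using hm
    rw [this, smul_zero]
  exact ⟨MvPowerSeries.aeval ha, key, fun p => by rw [← key, MvPowerSeries.aeval_coe]⟩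

variable (K) in
/-- Evaluation at a nilpotent point. -/
noncomputable def IsNilpotentPoint.evalHom {t : σ → R} (ht : IsNilpotentPoint t) :
    MvPowerSeries σ K →ₐ[K] R :=
  ht.exists_algHom.choose

theorem IsNilpotentPoint.evalHom_apply {t : σ → R} (ht : IsNilpotentPoint t)
    (G : MvPowerSeries σ K) : ht.evalHom K G = evalAt G t :=
  ht.exists_algHom.choose_spec.1 G

theorem IsNilpotentPoint.evalAt_coe {t : σ → R} (ht : IsNilpotentPoint t)
    (p : MvPolynomial σ K) : evalAt (p : MvPowerSeries σ K) t = MvPolynomial.aeval t p :=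
  ht.exists_algHom.choose_spec.2 p

theorem IsNilpotentPoint.evalHom_X {t : σ → R} (ht : IsNilpotentPoint t) (i : σ) :
    ht.evalHom K (MvPowerSeries.X i) = t i := by
  rw [ht.evalHom_apply, ← MvPolynomial.coe_X, ht.evalAt_coe, MvPolynomial.aeval_X]

theorem IsNilpotentPoint.isNilpotent_evalAt_sub {t : σ → R} (ht : IsNilpotentPoint t)
    (G : MvPowerSeries σ K) :
    IsNilpotent (evalAt G t - algebraMap K R (MvPowerSeries.constantCoeff G)) := by
  classical
  have h0 : (0 : σ →₀ ℕ) ∈ insert 0 ht.finite_monomials.toFinset := Finset.mem_insert_self _ _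
  rw [ht.evalAt_eq_sum (Finset.subset_insert 0 _), ← Finset.add_sum_erase _ _ h0,
    MvPowerSeries.coeff_zero_eq_constantCoeff_apply, Finsupp.prod_zero_index,
    ← Algebra.algebraMap_eq_smul_one, add_sub_cancel_left]
  refine isNilpotent_sum fun m hm => ?_
  obtain ⟨i, hi⟩ := Finsupp.ne_iff.mp (Finset.ne_of_mem_erase hm)
  have hi' : i ∈ m.support := Finsupp.mem_support_iff.mpr hi
  rw [Finsupp.prod, ← Finset.mul_prod_erase _ _ hi', Algebra.smul_def, mul_left_comm]
  exact (Commute.all _ _).isNilpotent_mul_right ((ht.isNilpotent i).pow_of_pos hi)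

theorem IsNilpotentPoint.map {t : σ → R} (ht : IsNilpotentPoint t) {R' : Type*} [CommRing R']
    [Algebra K R'] (g : R →ₐ[K] R') : IsNilpotentPoint fun i => g (t i) where
  finite_support := ht.finite_support.subset fun i hi h0 => hi (by simp [h0])
  isNilpotent i := (ht.isNilpotent i).map g

theorem IsNilpotentPoint.evalAt_map {t : σ → R} (ht : IsNilpotentPoint t) {R' : Type*}
    [CommRing R'] [Algebra K R'] (g : R →ₐ[K] R') (G : MvPowerSeries σ K) :
    evalAt G (fun i => g (t i)) = g (evalAt G t) := by
  classical
  rw [(ht.map g).evalAt_eq_sum (S := ht.finite_monomials.toFinset ∪ (ht.map g).finite_monomials.toFinset)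
    Finset.subset_union_right, ht.evalAt_eq_sum Finset.subset_union_left, map_sum]
  refine Finset.sum_congr rfl fun m _ => ?_
  rw [map_smul, map_finsuppProd]
  simp

theorem IsNilpotentPoint.evalAt_formalSum {t : σ → R} (ht : IsNilpotentPoint t) {κ : Type*}
    (f : κ → MvPowerSeries σ K)
    (hf : ∀ m, (Function.support fun j => MvPowerSeries.coeff m (f j)).Finite) :
    evalAt (formalSum f) t = ∑ᶠ j, evalAt (f j) t := by
  classical
  set S := ht.finite_monomials.toFinset with hS
  have hSS : ht.finite_monomials.toFinset ⊆ S := Finset.Subset.refl _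
  -- Only the finitely many monomials in `S` survive at `t`, and each occurs in finitely many `f j`;
  -- outside `J` every `f j` evaluates to zero.
  let J : Finset κ := S.biUnion fun m => (hf m).toFinset
  have h1 : ∀ m ∈ S, MvPowerSeries.coeff m (formalSum f) =
      ∑ j ∈ J, MvPowerSeries.coeff m (f j) := fun m hm => by
    change ∑ᶠ j, MvPowerSeries.coeff m (f j) = _
    refine finsum_eq_sum_of_support_subset _ fun j hj => ?_
    exact Finset.mem_biUnion.mpr ⟨m, hm, (hf m).mem_toFinset.mpr hj⟩
  rw [finsum_eq_sum_of_support_subset (s := J), ht.evalAt_eq_sum hSS]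
  · simp_rw [ht.evalAt_eq_sum hSS]
    rw [Finset.sum_comm]
    refine Finset.sum_congr rfl fun m hm => ?_
    rw [h1 m hm, Finset.sum_smul]
  · intro j hj
    by_contra hJ
    refine hj ?_
    change evalAt (f j) t = 0
    rw [ht.evalAt_eq_sum hSS]
    refine Finset.sum_eq_zero fun m hm => ?_
    have : MvPowerSeries.coeff m (f j) = 0 := by
      by_contra h
      exact hJ (Finset.mem_biUnion.mpr ⟨m, hm, (hf m).mem_toFinset.mpr h⟩)
    rw [this, zero_smul]

theorem pderiv_formalSum {κ : Type*} (f : κ → MvPowerSeries σ K) (i : σ) :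
    MvPowerSeries.pderiv K i (formalSum f) = formalSum fun j => MvPowerSeries.pderiv K i (f j) := by
  ext m
  rw [MvPowerSeries.coeff_pderiv]
  change (∑ᶠ j, _) * _ = ∑ᶠ j, MvPowerSeries.coeff m (MvPowerSeries.pderiv K i (f j))
  simp_rw [MvPowerSeries.coeff_pderiv]
  have := smul_finsum (m i + 1 : K) fun j => MvPowerSeries.coeff (m + Finsupp.single i 1) (f j)
  simp only [smul_eq_mul] at this
  rw [mul_comm, this]
  exact finsum_congr fun j => mul_comm _ _

theorem pderiv_pderiv_comm (i j : σ) (G : MvPowerSeries σ K) :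
    MvPowerSeries.pderiv K i (MvPowerSeries.pderiv K j G) =
      MvPowerSeries.pderiv K j (MvPowerSeries.pderiv K i G) := by
  classical
  ext m
  simp only [MvPowerSeries.coeff_pderiv, Finsupp.add_apply, Finsupp.single_apply]
  by_cases h : i = j
  · subst h; rfl
  · rw [if_neg h, if_neg (Ne.symm h), add_right_comm]
    simp only [add_zero]
    ring

/-- The chain rule for derivations and polynomials. -/
theorem derivation_aeval_eq_sum {A : Type*} [CommRing A] [Algebra K A] (D : Derivation K A A)
    (T : σ → A) (J : Finset σ) (hJ : ∀ j ∉ J, D (T j) = 0) (p : MvPolynomial σ K) :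
    D (MvPolynomial.aeval T p) =
      ∑ j ∈ J, D (T j) * MvPolynomial.aeval T (MvPolynomial.pderiv j p) := by
  classical
  induction p using MvPolynomial.induction_on with
  | C a => simp
  | add p q hp hq => simp only [map_add, hp, hq, mul_add, Finset.sum_add_distrib]
  | mul_X p i hp =>
    simp only [map_mul, Derivation.leibniz, hp, MvPolynomial.aeval_X, smul_eq_mul, map_add,
      MvPolynomial.pderiv_X, mul_add, Finset.sum_add_distrib, Finset.mul_sum]
    congr 1
    · by_cases hi : i ∈ J
      · rw [Finset.sum_eq_single_of_mem i hi]
        · simp [mul_comm]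
        · intro j _ hji
          simp [hji.symm]
      · rw [hJ i hi, mul_zero]
        refine (Finset.sum_eq_zero fun j hj => ?_).symm
        have : i ≠ j := fun h => hi (h ▸ hj)
        simp [this]
    · exact Finset.sum_congr rfl fun j _ => by ring

/-- The chain rule for derivations and formal functions. -/
theorem IsNilpotentPoint.derivation_evalAt {T : σ → R} (hT : IsNilpotentPoint T)
    (D : Derivation K R R) (G : MvPowerSeries σ K) :
    D (evalAt G T) = ∑ᶠ j, D (T j) * evalAt (MvPowerSeries.pderiv K j G) T := by
  classical
  set J := hT.finite_support.toFinset with hJdef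
  have hJ : ∀ j ∉ J, D (T j) = 0 := fun j hj => by
    have : T j = 0 := by simpa [hJdef] using hj
    rw [this, map_zero]
  set M := hT.finite_monomials.toFinset with hMdef
  have hMM : hT.finite_monomials.toFinset ⊆ M := Finset.Subset.refl _
  -- `G` is truncated to a polynomial. The coefficient of `m` in the `j`-th derivative comes from `m
  -- + single j 1`, so these exponents are kept as well.
  let S : Finset (σ →₀ ℕ) := M ∪ J.biUnion fun j => M.image fun m => m + Finsupp.single j 1
  let p : MvPolynomial σ K := ∑ m ∈ S, MvPolynomial.monomial m (MvPowerSeries.coeff m G)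
  have hp : ∀ m ∈ S, p.coeff m = MvPowerSeries.coeff m G := fun m hm => by
    simp [p, MvPolynomial.coeff_sum, MvPolynomial.coeff_monomial, hm]
  have h0 : evalAt G T = MvPolynomial.aeval T p := by
    rw [← hT.evalAt_coe, hT.evalAt_eq_sum hMM, hT.evalAt_eq_sum hMM]
    refine Finset.sum_congr rfl fun m hm => ?_
    rw [MvPolynomial.coeff_coe, hp m (Finset.mem_union_left _ hm)]
  have h1 : ∀ j ∈ J, evalAt (MvPowerSeries.pderiv K j G) T =
      MvPolynomial.aeval T (MvPolynomial.pderiv j p) := fun j hj => by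
    rw [← hT.evalAt_coe, ← MvPowerSeries.pderiv_coe, hT.evalAt_eq_sum hMM, hT.evalAt_eq_sum hMM]
    refine Finset.sum_congr rfl fun m hm => ?_
    rw [MvPowerSeries.coeff_pderiv, MvPowerSeries.coeff_pderiv, MvPolynomial.coeff_coe, hp]
    exact Finset.mem_union_right _
      (Finset.mem_biUnion.mpr ⟨j, hj, Finset.mem_image_of_mem _ hm⟩)
  rw [h0, derivation_aeval_eq_sum D T J hJ p, finsum_eq_sum_of_support_subset (s := J)]
  · exact Finset.sum_congr rfl fun j hj => by rw [h1 j hj]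
  · intro j hj
    by_contra h
    exact hj (by simp [hJ j h])

open Polynomial in
/-- Uniqueness of the solution of a linear system of differential equations. -/
theorem eq_zero_of_derivative_dvd [CharZero K] {κ : Type*} (W : κ → R[X])
    (h0 : ∀ c, (W c).coeff 0 = 0)
    (hW : ∀ n, (∀ c, X ^ n ∣ W c) → ∀ c, X ^ n ∣ derivative (W c)) (c : κ) : W c = 0 := by
  have key : ∀ n, ∀ c, X ^ n ∣ W c := by
    intro n
    induction n with
    | zero => simp
    | succ n ih =>
      intro c
      -- Coefficient `d` of the derivative is `d + 1` times coefficient `d + 1` of `W c`, and `d +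
      -- 1` is invertible in `K`; so each step gains one power of `X`.
      rw [X_pow_dvd_iff]
      intro d hd
      rcases d with _ | d
      · exact h0 c
      · have h := X_pow_dvd_iff.mp (hW n ih c) d (by omega)
        rw [coeff_derivative, ← map_natCast (algebraMap K R), ← map_one (algebraMap K R),
          ← map_add, mul_comm, ← Algebra.smul_def] at h
        have hne : ((d : K) + 1) ≠ 0 := by exact_mod_cast Nat.succ_ne_zero d
        rw [← inv_smul_smul₀ hne ((W c).coeff (d + 1)), h, smul_zero]
  ext d
  exact (X_pow_dvd_iff.mp (key (d + 1) c) d (Nat.lt_succ_self d)).trans (coeff_zero d).symm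

end Evaluation

/-! ### Nilpotent points separate formal functions -/

section Separation
open Polynomial

/-- A formal function that vanishes at all nilpotent points is zero. -/
theorem eq_zero_of_forall_evalAt_eq_zero {K : Type u} [Field K] [Infinite K] {σ : Type*}
    (G : MvPowerSeries σ K)
    (h : ∀ (R : Type u) [CommRing R] [Algebra K R] (t : σ → R), IsNilpotentPoint t →
      evalAt G t = 0) : G = 0 := by
  classical
  ext m
  set N := m.degree with hN
  -- The test points are `t_i = c_i X` in `K[X]/(X^(N+1))`, for `i` in the support of `m`. The
  -- coefficient of `X^N` in the value of `G` is then the homogeneous part `p` of degree `N` at `c`,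
  -- and `K` is infinite.
  let I : Ideal K[X] := Ideal.span {X ^ (N + 1)}
  let S : Finset (σ →₀ ℕ) := m.support.finsupp fun _ => Finset.range (N + 1)
  let p : MvPolynomial σ K :=
    ∑ m' ∈ S with m'.degree = N, MvPolynomial.monomial m' (MvPowerSeries.coeff m' G)
  have hp : p = 0 := by
    refine MvPolynomial.funext fun c => ?_
    let t : σ → K[X] ⧸ I := fun i =>
      if i ∈ m.support then Ideal.Quotient.mkₐ K I (C (c i) * X) else 0
    have hX : ∀ n, N < n → (Ideal.Quotient.mkₐ K I (X : K[X])) ^ n = 0 := fun n hn => by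
      rw [← map_pow]
      exact Ideal.Quotient.eq_zero_iff_mem.mpr
        (Ideal.mem_span_singleton.mpr (pow_dvd_pow X hn))
    have ht0 : ∀ i ∉ m.support, t i = 0 := fun i hi => if_neg hi
    have htN : ∀ i n, N < n → t i ^ n = 0 := fun i n hn => by
      simp only [t]
      split_ifs
      · rw [map_mul, mul_pow, hX n hn, mul_zero]
      · exact zero_pow (by omega)
    have ht : IsNilpotentPoint t :=
      ⟨m.support.finite_toSet.subset fun i hi => by_contra fun h => hi (ht0 i h),
        fun i => ⟨N + 1, htN i _ (Nat.lt_succ_self N)⟩⟩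
    have hS : ht.finite_monomials.toFinset ⊆ S := fun m' hm' => by
      rw [Set.Finite.mem_toFinset, Set.mem_ofPred_eq] at hm'
      have key : ∀ i ∈ m'.support, t i ^ m' i ≠ 0 := fun i hi h0 =>
        hm' (Finset.prod_eq_zero hi h0)
      rw [Finset.mem_finsupp_iff]
      refine ⟨fun i hi => by_contra fun hc => key i hi ?_, fun i hi => ?_⟩
      · rw [ht0 i hc, zero_pow (Finsupp.mem_support_iff.mp hi)]
      · rw [Finset.mem_range]
        by_contra hlt
        by_cases hi' : i ∈ m'.support
        · exact key i hi' (htN i _ (by omega))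
        · rw [Finsupp.notMem_support_iff] at hi'
          omega
    have h1 := h _ t ht
    rw [ht.evalAt_eq_sum hS] at h1
    have h2 : ∀ m' ∈ S, MvPowerSeries.coeff m' G • (m'.prod fun i n => t i ^ n) =
        Ideal.Quotient.mkₐ K I
          (C (MvPowerSeries.coeff m' G * m'.prod fun i n => c i ^ n) * X ^ m'.degree) := by
      intro m' hm'
      have hsupp := (Finset.mem_finsupp_iff.mp hm').1
      have h3 : (m'.prod fun i n => t i ^ n) =
          Ideal.Quotient.mkₐ K I (C (m'.prod fun i n => c i ^ n) * X ^ m'.degree) := by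
        rw [Finsupp.prod, Finsupp.prod, Finsupp.degree_apply, map_prod, ← Finset.prod_pow_eq_pow_sum,
          ← Finset.prod_mul_distrib, map_prod]
        refine Finset.prod_congr rfl fun i hi => ?_
        simp only [t, if_pos (hsupp hi)]
        rw [← map_pow, mul_pow, C_pow]
      rw [h3, ← map_smul, C_mul, mul_assoc, smul_eq_C_mul]
    rw [Finset.sum_congr rfl h2, ← map_sum] at h1
    have h4 := Ideal.mem_span_singleton.mp (Ideal.Quotient.eq_zero_iff_mem.mp h1)
    have h5 := X_pow_dvd_iff.mp h4 N (Nat.lt_succ_self N)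
    rw [finsetSum_coeff] at h5
    rw [map_zero, map_sum, Finset.sum_filter]
    refine Eq.trans ?_ h5
    refine Finset.sum_congr rfl fun m' _ => ?_
    rw [coeff_C_mul, coeff_X_pow, MvPolynomial.eval_monomial, mul_ite, mul_one, mul_zero]
    simp only [eq_comm]
  have hm : m ∈ S := by
    rw [Finset.mem_finsupp_iff]
    refine ⟨Finset.Subset.refl _, fun i hi => Finset.mem_range.mpr (Nat.lt_succ_of_le ?_)⟩
    exact Finsupp.le_degree i m
  have h6 : p.coeff m = MvPowerSeries.coeff m G := by
    simp [p, MvPolynomial.coeff_sum, MvPolynomial.coeff_monomial, hm, hN]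
  rw [← h6, hp]
  simp

end Separation

/-! ### Darboux coordinates on the loop space -/

section LoopSpace

variable {K : Type u} [Field K] {H : Type v} [AddCommGroup H] [Module K H]
  {R : Type u} [CommRing R] [Algebra K R] {ι : Type w}
  (B : LinearMap.BilinForm K H) (φ : Module.Basis ι K H) (e : ι)

/-- The matrix inverse to the Gram matrix. -/
noncomputable def gramInv [Fintype ι] [DecidableEq ι] : Matrix ι ι K :=
  (Matrix.of fun a b => B (φ a) (φ b))⁻¹

theorem pCoord_apply (f : LoopSpace K H R) (i : ℕ × ι) :
    pCoord B φ f i =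
      (-1 - (i.1 : ℤ)).negOnePow • (B.baseChange R) (f.1 (-1 - i.1)) (φ.baseChange R i.2) := by
  rw [pCoord, Omega, finsum_eq_single _ (-1 - (i.1 : ℤ))]
  · have h1 : (-1 - (-1 - (i.1 : ℤ))) = i.1 := by ring
    have h2 : (-1 - (i.1 : ℤ)) < 0 := by omega
    simp [minusPart, monomialZ, h1, h2]
  · intro n hn
    have : -1 - n ≠ (i.1 : ℤ) := fun h => hn (by omega)
    simp [monomialZ, this]

theorem qCoord_add (f g : LoopSpace K H R) (i : ℕ × ι) :
    qCoord φ (f + g) i = qCoord φ f i + qCoord φ g i := by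
  simp [qCoord]

theorem qCoord_sub (f g : LoopSpace K H R) (i : ℕ × ι) :
    qCoord φ (f - g) i = qCoord φ f i - qCoord φ g i := by
  simp [qCoord]

theorem qCoord_smul (c : R) (f : LoopSpace K H R) (i : ℕ × ι) :
    qCoord φ (c • f) i = c * qCoord φ f i := by
  simp [qCoord]

theorem pCoord_add (f g : LoopSpace K H R) (i : ℕ × ι) :
    pCoord B φ (f + g) i = pCoord B φ f i + pCoord B φ g i := by
  simp [pCoord_apply]

theorem pCoord_sub (f g : LoopSpace K H R) (i : ℕ × ι) :
    pCoord B φ (f - g) i = pCoord B φ f i - pCoord B φ g i := by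
  simp [pCoord_apply, smul_sub]

theorem pCoord_smul (c : R) (f : LoopSpace K H R) (i : ℕ × ι) :
    pCoord B φ (c • f) i = c * pCoord B φ f i := by
  simp [pCoord_apply, mul_smul_comm]

theorem qCoord_mulZ_succ (f : LoopSpace K H R) (k : ℕ) (α : ι) :
    qCoord φ (mulZ f) (k + 1, α) = qCoord φ f (k, α) := by
  simp [qCoord, mulZ]

/-- The sign reflects the argument `-z` in `Ω`: multiplication by `z` is skew-adjoint. -/
theorem pCoord_mulZ (f : LoopSpace K H R) (k : ℕ) (α : ι) :
    pCoord B φ (mulZ f) (k, α) = - pCoord B φ f (k + 1, α) := by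
  have h : (-1 - (k : ℤ) - 1) = -1 - (k + 1 : ℤ) := by ring
  simp only [pCoord_apply, mulZ, Nat.cast_add, Nat.cast_one, h]
  rw [show (-1 - (k : ℤ)) = (-1 - (k + 1 : ℤ)) + 1 by ring, Int.negOnePow_succ, Units.neg_smul]

theorem finite_support_qCoord [Finite ι] (f : LoopSpace K H R) :
    (Function.support (qCoord φ f)).Finite := by
  obtain ⟨N, hN⟩ := f.2
  refine ((Set.finite_Iic N.toNat).prod (Set.finite_univ (α := ι))).subset ?_
  rintro ⟨k, α⟩ hk
  refine ⟨?_, Set.mem_univ _⟩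
  rw [Set.mem_Iic]
  by_contra hlt
  refine hk ?_
  rw [qCoord, hN k (by omega)]
  simp

variable [Fintype ι]

theorem sum_repr_mul_gram (x : R ⊗[K] H) (α : ι) :
    (B.baseChange R) x (φ.baseChange R α) =
      ∑ β, (φ.baseChange R).repr x β * algebraMap K R (B (φ β) (φ α)) := by
  conv_lhs => rw [← (φ.baseChange R).sum_repr x]
  rw [map_sum, LinearMap.sum_apply]
  refine Finset.sum_congr rfl fun β _ => ?_
  rw [map_smul, LinearMap.smul_apply, smul_eq_mul, Module.Basis.baseChange_apply,
    Module.Basis.baseChange_apply, LinearMap.BilinForm.baseChange_tmul, mul_one,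
    Algebra.algebraMap_eq_smul_one]

/-- The exponents `-1 - k` contribute the `pq` terms and the exponents `k ≥ 0` the `qp` terms, with
opposite signs since the two exponents have opposite parity. -/
theorem Omega_eq_finsum (hsymm : B.IsSymm) (f g : LoopSpace K H R) :
    Omega B f g = ∑ᶠ i : ℕ × ι, (pCoord B φ f i * qCoord φ g i - qCoord φ f i * pCoord B φ g i) := by
  have hB : ∀ x y : R ⊗[K] H, (B.baseChange R) x y =
      ∑ α, (φ.baseChange R).repr y α * (B.baseChange R) x (φ.baseChange R α) := fun x y => by
    conv_lhs => rw [← (φ.baseChange R).sum_repr y]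
    rw [map_sum]
    exact Finset.sum_congr rfl fun α _ => by rw [map_smul, smul_eq_mul]
  have hB' : ∀ x y : R ⊗[K] H, (B.baseChange R) x y = (B.baseChange R) y x :=
    (LinearMap.BilinForm.IsSymm.baseChange R (B₂ := B) ⟨fun x y => hsymm.eq x y⟩).eq
  have hqp : ∀ (h h' : LoopSpace K H R),
      (Function.support fun i => qCoord φ h i * pCoord B φ h' i).Finite := fun h h' =>
    (finite_support_qCoord φ h).subset fun i hi h0 => hi (by simp [h0])
  have hpq : ∀ (h h' : LoopSpace K H R),
      (Function.support fun i => pCoord B φ h' i * qCoord φ h i).Finite := fun h h' =>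
    (finite_support_qCoord φ h).subset fun i hi h0 => hi (by simp [h0])
  have hunion : (Set.univ : Set ℤ) = Set.range (fun k : ℕ => -1 - (k : ℤ)) ∪
      Set.range (fun k : ℕ => (k : ℤ)) := by
    ext n
    simp only [Set.mem_univ, Set.mem_union, Set.mem_range, true_iff]
    rcases Int.lt_or_le n 0 with hn | hn
    · exact Or.inl ⟨(-1 - n).toNat, by omega⟩
    · exact Or.inr ⟨n.toNat, by omega⟩
  have hdisj : Disjoint (Set.range (fun k : ℕ => -1 - (k : ℤ)))
      (Set.range (fun k : ℕ => (k : ℤ))) := by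
    rw [Set.disjoint_left]
    rintro n ⟨k, rfl⟩ ⟨l, hl⟩
    simp only at hl
    omega
  have hfin := Omega_support_finite B f g
  rw [finsum_sub_distrib (hpq g f) (hqp f g), finsum_curry _ (hpq g f), finsum_curry _ (hqp f g),
    Omega, ← finsum_mem_univ, hunion,
    finsum_mem_union' hdisj (hfin.subset Set.inter_subset_right)
      (hfin.subset Set.inter_subset_right),
    finsum_mem_range (fun a b h => by simpa using h),
    finsum_mem_range (fun a b h => by simpa using h), sub_eq_add_neg, ← finsum_neg_distrib]
  congr 1
  · refine finsum_congr fun k => ?_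
    rw [finsum_eq_sum_of_fintype, show (-1 - (-1 - (k : ℤ))) = k by ring, hB, Finset.smul_sum]
    refine Finset.sum_congr rfl fun α _ => ?_
    rw [pCoord_apply, smul_mul_assoc, mul_comm]
    rfl
  · refine finsum_congr fun k => ?_
    rw [finsum_eq_sum_of_fintype, hB', hB, Finset.smul_sum, ← Finset.sum_neg_distrib]
    refine Finset.sum_congr rfl fun α _ => ?_
    have : (-1 - (k : ℤ)).negOnePow = - (k : ℤ).negOnePow := by
      rw [Int.negOnePow_sub, Int.negOnePow_neg, Int.negOnePow_one, neg_mul, one_mul]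
    rw [pCoord_apply, this, Units.neg_smul, mul_neg, neg_neg, mul_smul_comm]
    rfl

variable [DecidableEq ι] {B}

theorem gram_mul_gramInv (hB : B.Nondegenerate) :
    (Matrix.of fun a b => B (φ a) (φ b)) * gramInv B φ = 1 := by
  refine Matrix.mul_nonsing_inv _ (isUnit_iff_ne_zero.mpr ?_)
  have h := (LinearMap.BilinForm.nondegenerate_iff_det_ne_zero (B := B) φ).mp hB
  convert h using 2
  ext a b
  simp [LinearMap.BilinForm.toMatrix_apply]

theorem gramInv_symm (hsymm : B.IsSymm) (α β : ι) : gramInv B φ α β = gramInv B φ β α := by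
  have : (gramInv B φ).transpose = gramInv B φ := by
    rw [gramInv, Matrix.transpose_nonsing_inv]
    congr 1
    ext a b
    exact hsymm.eq _ _
  exact congrFun (congrFun this β) α

theorem sum_gram_mul_gramInv (hB : B.Nondegenerate) (β γ : ι) :
    ∑ α, B (φ β) (φ α) * gramInv B φ α γ = if β = γ then 1 else 0 := by
  have := congrFun (congrFun (gram_mul_gramInv φ hB) β) γ
  rwa [Matrix.mul_apply, Matrix.one_apply] at this

theorem repr_eq_sum_gramInv (hB : B.Nondegenerate) (x : R ⊗[K] H) (γ : ι) :
    (φ.baseChange R).repr x γ =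
      ∑ α, algebraMap K R (gramInv B φ α γ) * (B.baseChange R) x (φ.baseChange R α) := by
  simp_rw [sum_repr_mul_gram, Finset.mul_sum]
  rw [Finset.sum_comm]
  have : ∀ β, ∑ α, algebraMap K R (gramInv B φ α γ) *
      ((φ.baseChange R).repr x β * algebraMap K R (B (φ β) (φ α))) =
      (φ.baseChange R).repr x β * algebraMap K R (if β = γ then 1 else 0) := fun β => by
    rw [← sum_gram_mul_gramInv φ hB, map_sum, Finset.mul_sum]
    refine Finset.sum_congr rfl fun α _ => ?_
    rw [map_mul]
    ring
  simp [this]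

/-- The coefficient of `z⁻¹` is the one that crosses from `p` into `q`; this is the source of the
`g^{μν}` terms in the recursion. -/
theorem qCoord_mulZ_zero (hB : B.Nondegenerate) (f : LoopSpace K H R) (γ : ι) :
    qCoord φ (mulZ f) (0, γ) =
      - ∑ α, algebraMap K R (gramInv B φ α γ) * pCoord B φ f (0, α) := by
  simp [qCoord, mulZ, pCoord_apply, repr_eq_sum_gramInv φ hB]

variable (R) in
theorem exists_qCoord_pCoord (hB : B.Nondegenerate) (q p : ℕ × ι → R)
    (hq : (Function.support q).Finite) :
    ∃ f : LoopSpace K H R, (∀ i, qCoord φ f i = q i) ∧ ∀ i, pCoord B φ f i = p i := by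
  obtain ⟨N, hN⟩ := (hq.image Prod.fst).bddAbove
  have hqN : ∀ k α, N < k → q (k, α) = 0 := fun k α hk => by
    by_contra h
    have := hN ⟨(k, α), h, rfl⟩
    simp only at this
    omega
  refine ⟨⟨fun n => (φ.baseChange R).repr.symm (Finsupp.equivFunOnFinite.symm fun γ =>
    if 0 ≤ n then q (n.toNat, γ) else
      n.negOnePow • ∑ α, algebraMap K R (gramInv B φ α γ) * p ((-1 - n).toNat, α)),
    N, fun n hn => ?_⟩, fun i => ?_, fun i => ?_⟩
  · rw [LinearEquiv.map_eq_zero_iff]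
    ext γ
    have : 0 ≤ n := by omega
    simp [this, hqN n.toNat γ (by omega)]
  · simp [qCoord]
  · have h1 : ¬ (0 ≤ -1 - (i.1 : ℤ)) := by omega
    have h2 : (-1 - (-1 - (i.1 : ℤ))).toNat = i.1 := by omega
    rw [pCoord_apply, sum_repr_mul_gram]
    simp only [h1, h2, if_false, LinearEquiv.apply_symm_apply, Finsupp.equivFunOnFinite_symm_apply_apply]
    simp_rw [smul_mul_assoc]
    rw [← Finset.smul_sum, smul_smul, Int.units_mul_self, one_smul]
    simp_rw [Finset.sum_mul]
    rw [Finset.sum_comm]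
    have : ∀ α, ∑ β, algebraMap K R (gramInv B φ α β) * p (i.1, α) *
        algebraMap K R (B (φ β) (φ i.2)) = p (i.1, α) *
          algebraMap K R (if α = i.2 then 1 else 0) := fun α => by
      have h3 : gramInv B φ * (Matrix.of fun a b => B (φ a) (φ b)) = 1 :=
        mul_eq_one_comm.mp (gram_mul_gramInv φ hB)
      have h4 := congrFun (congrFun h3 α) i.2
      rw [Matrix.mul_apply, Matrix.one_apply] at h4
      rw [← h4, map_sum, Finset.mul_sum]
      refine Finset.sum_congr rfl fun β _ => ?_
      rw [map_mul, Matrix.of_apply]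
      ring
    simp [this]

end LoopSpace

/-! ### Derivatives and values of the sums `∑ t_{a j} G_j` -/

section FormalSum

variable {K : Type*} [Field K] {σ κ : Type*}

theorem formalSum_X_mul_add {a : κ → σ} (ha : Function.Injective a)
    (E G : κ → MvPowerSeries σ K)
    (hE : ∀ m, (Function.support fun j => MvPowerSeries.coeff m (E j)).Finite) :
    formalSum (fun j => E j + MvPowerSeries.X (a j) * G j) =
      formalSum E + formalSum fun j => MvPowerSeries.X (a j) * G j := by
  ext m
  rw [map_add]
  change (∑ᶠ j, MvPowerSeries.coeff m _) = (∑ᶠ j, _) + (∑ᶠ j, _)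
  simp_rw [map_add]
  exact finsum_add_distrib (hE m) (formalSum_support_finite a ha G m)

theorem pderiv_formalSum_X_mul_apply {a : κ → σ} (ha : Function.Injective a)
    (G : κ → MvPowerSeries σ K) (j : κ) :
    MvPowerSeries.pderiv K (a j) (formalSum fun j => MvPowerSeries.X (a j) * G j) =
      G j + formalSum fun l => MvPowerSeries.X (a l) * MvPowerSeries.pderiv K (a j) (G l) := by
  classical
  have h : ∀ l, MvPowerSeries.pderiv K (a j) (MvPowerSeries.X (a l) * G l) =
      (if l = j then G j else 0) +
        MvPowerSeries.X (a l) * MvPowerSeries.pderiv K (a j) (G l) := fun l => by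
    rw [Derivation.leibniz, smul_eq_mul, smul_eq_mul, add_comm]
    congr 1
    split_ifs with hl
    · rw [hl, MvPowerSeries.pderiv_X_self, mul_one]
    · rw [MvPowerSeries.pderiv_X_of_ne (ha.ne hl), mul_zero]
  rw [pderiv_formalSum]
  simp_rw [h]
  rw [formalSum_X_mul_add ha]
  · congr 1
    ext m
    refine (finsum_eq_single _ j fun l hl => ?_).trans ?_
    · simp only [if_neg hl, map_zero]
    · simp only [if_true]
  · intro m
    refine (Set.finite_singleton j).subset fun l hl => ?_
    by_contra hlj
    exact hl (by simp only [if_neg (show l ≠ j from hlj), map_zero])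

theorem pderiv_formalSum_X_mul_of_forall_ne {a : κ → σ} {i : σ} (hi : ∀ j, a j ≠ i)
    (G : κ → MvPowerSeries σ K) :
    MvPowerSeries.pderiv K i (formalSum fun j => MvPowerSeries.X (a j) * G j) =
      formalSum fun j => MvPowerSeries.X (a j) * MvPowerSeries.pderiv K i (G j) := by
  rw [pderiv_formalSum]
  congr 1
  funext j
  rw [Derivation.leibniz, MvPowerSeries.pderiv_X_of_ne (hi j), smul_zero, add_zero, smul_eq_mul]

theorem constantCoeff_formalSum_X_mul (a : κ → σ) (G : κ → MvPowerSeries σ K) :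
    MvPowerSeries.constantCoeff (formalSum fun j => MvPowerSeries.X (a j) * G j) = 0 := by
  rw [← MvPowerSeries.coeff_zero_eq_constantCoeff_apply]
  refine (finsum_congr fun j => ?_).trans finsum_zero
  simp

theorem IsNilpotentPoint.evalAt_formalSum_X_mul {R : Type*} [CommRing R] [Algebra K R] {t : σ → R}
    (ht : IsNilpotentPoint t) {a : κ → σ} (ha : Function.Injective a)
    (G : κ → MvPowerSeries σ K) :
    evalAt (formalSum fun j => MvPowerSeries.X (a j) * G j) t = ∑ᶠ j, t (a j) * evalAt (G j) t := by
  rw [ht.evalAt_formalSum _ (formalSum_support_finite a ha G)]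
  refine finsum_congr fun j => ?_
  rw [← ht.evalHom_apply, map_mul, ht.evalHom_X, ht.evalHom_apply]

end FormalSum

/-! ### Defects of the dilaton and string equations -/

section Defects

variable {K : Type*} [Field K] {ι : Type*} (e : ι) (F : MvPowerSeries (ℕ × ι) K)

/-- The difference of the two sides of the dilaton equation. -/
noncomputable def dilatonDefect : MvPowerSeries (ℕ × ι) K :=
  formalSum (fun j : ℕ × ι => MvPowerSeries.X j * del j F) - 2 * F - del (1, e) F

theorem dilatonEquation_iff : DilatonEquation e F ↔ dilatonDefect e F = 0 := by
  rw [DilatonEquation, dilatonDefect, sub_eq_zero, eq_comm]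

theorem constantCoeff_dilatonDefect :
    MvPowerSeries.constantCoeff (dilatonDefect e F) =
      -(2 * MvPowerSeries.constantCoeff F) - MvPowerSeries.constantCoeff (del (1, e) F) := by
  rw [dilatonDefect, map_sub, map_sub, constantCoeff_formalSum_X_mul, map_mul, map_ofNat, zero_sub]

theorem del_dilatonDefect (i : ℕ × ι) : del i (dilatonDefect e F) =
    (del i F + formalSum fun j => MvPowerSeries.X j * del j (del i F)) - (2 : K) • del i F -
      del (1, e) (del i F) := by
  have h3 : (2 : MvPowerSeries (ℕ × ι) K) * F = (2 : K) • F := by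
    rw [MvPowerSeries.smul_eq_C_mul, map_ofNat]
  simp only [dilatonDefect, del, map_sub, h3, Derivation.map_smul, pderiv_pderiv_comm i (1, e)]
  have h4 := pderiv_formalSum_X_mul_apply (a := id) Function.injective_id
    (fun j => MvPowerSeries.pderiv K j F) i
  simp only [id] at h4
  rw [h4]
  simp only [pderiv_pderiv_comm i]

/-- The dilaton shift absorbs the `∂_{1,1}` term into the Euler field `∑ q_j ∂_j`; vanishing means
that `∂_i F` is homogeneous of degree one in `q`. -/
theorem evalAt_del_dilatonDefect {R : Type*} [CommRing R] [Algebra K R] {t q : ℕ × ι → R}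
    (ht : IsNilpotentPoint t) (hq : ∀ j, j ≠ (1, e) → q j = t j)
    (hqe : q (1, e) = t (1, e) - 1) (i : ℕ × ι) :
    evalAt (del i (dilatonDefect e F)) t =
      (∑ᶠ j, q j * evalAt (del j (del i F)) t) - evalAt (del i F) t := by
  classical
  have h1 : (∑ᶠ j, q j * evalAt (del j (del i F)) t) =
      (∑ᶠ j, t j * evalAt (del j (del i F)) t) - evalAt (del (1, e) (del i F)) t := by
    -- The isolated term is rewritten as a sum with one non-zero summand, so that the two sums merge
    -- termwise.
    rw [sub_eq_add_neg, ← finsum_eq_single (fun j => if j = (1, e) then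
        -evalAt (del j (del i F)) t else 0) (1, e) (fun j hj => if_neg hj) |>.trans (if_pos rfl),
      ← finsum_add_distrib]
    · refine finsum_congr fun j => ?_
      split_ifs with hj
      · rw [hj, hqe]
        ring
      · rw [hq j hj, add_zero]
    · exact ht.finite_support.subset fun j hj h0 => hj (by simp [h0])
    · exact (Set.finite_singleton ((1, e) : ℕ × ι)).subset fun j hj => by
        by_contra h
        exact hj (if_neg h)
  rw [h1, del_dilatonDefect, ← ht.evalHom_apply]
  simp only [map_sub, map_add, map_smul]
  simp only [ht.evalHom_apply]
  rw [ht.evalAt_formalSum_X_mul (a := fun j => j) Function.injective_id, two_smul]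
  ring

variable {H : Type*} [AddCommGroup H] [Module K H] [Fintype ι] (B : LinearMap.BilinForm K H)
  (φ : Module.Basis ι K H)

/-- The quadratic function `(t_0, t_0) / 2`. -/
noncomputable def halfSquare : MvPowerSeries (ℕ × ι) K :=
  (2⁻¹ : K) • ∑ α, ∑ β, B (φ α) (φ β) •
    (MvPowerSeries.X ((0, α) : ℕ × ι) * MvPowerSeries.X ((0, β) : ℕ × ι))

theorem del_succ_halfSquare (k : ℕ) (γ : ι) : del (k + 1, γ) (halfSquare B φ) = 0 := by
  have h : ∀ α : ι, MvPowerSeries.pderiv K (k + 1, γ)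
      (MvPowerSeries.X (0, α) : MvPowerSeries (ℕ × ι) K) = 0 :=
    fun α => MvPowerSeries.pderiv_X_of_ne (by simp)
  simp [halfSquare, del, map_sum, h]

theorem constantCoeff_halfSquare : MvPowerSeries.constantCoeff (halfSquare B φ) = 0 := by
  simp [halfSquare, MvPowerSeries.smul_eq_C_mul, map_sum]

variable {B} in
theorem del_zero_halfSquare [CharZero K] (hsymm : B.IsSymm) (γ : ι) :
    del (0, γ) (halfSquare B φ) = ∑ α, B (φ α) (φ γ) • MvPowerSeries.X ((0, α) : ℕ × ι) := by
  classical
  have h : ∀ α : ι, MvPowerSeries.pderiv K (0, γ)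
      (MvPowerSeries.X (0, α) : MvPowerSeries (ℕ × ι) K) = if α = γ then 1 else 0 := fun α => by
    split_ifs with hα
    · rw [hα, MvPowerSeries.pderiv_X_self]
    · exact MvPowerSeries.pderiv_X_of_ne (by simp [hα])
  have hs : ∀ α, B (φ γ) (φ α) = B (φ α) (φ γ) := fun α => hsymm.eq _ _
  simp only [halfSquare, del, Derivation.map_smul, map_sum, Derivation.leibniz, h, smul_eq_mul, mul_ite,
    mul_one, mul_zero, smul_add, Finset.sum_add_distrib, smul_ite, smul_zero,
    Finset.sum_ite_eq', Finset.mem_univ, if_true]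
  rw [Finset.sum_comm (γ := ι)]
  simp only [Finset.sum_ite_eq', Finset.mem_univ, if_true, hs]
  rw [← add_smul]
  norm_num

/-- The difference of the two sides of the string equation. -/
noncomputable def stringDefect : MvPowerSeries (ℕ × ι) K :=
  halfSquare B φ + formalSum (fun j : ℕ × ι => MvPowerSeries.X (j.1 + 1, j.2) * del j F) -
    del (0, e) F

theorem stringEquation_iff : StringEquation B φ e F ↔ stringDefect e F B φ = 0 := by
  rw [StringEquation, stringDefect, sub_eq_zero, eq_comm, halfSquare]

theorem constantCoeff_stringDefect : MvPowerSeries.constantCoeff (stringDefect e F B φ) =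
    -MvPowerSeries.constantCoeff (del (0, e) F) := by
  rw [stringDefect, map_sub, map_add, constantCoeff_halfSquare, constantCoeff_formalSum_X_mul,
    zero_add, zero_sub]

omit [Fintype ι] in
theorem shift_injective : Function.Injective fun j : ℕ × ι => (j.1 + 1, j.2) := by
  rintro ⟨k, α⟩ ⟨l, β⟩ h
  simpa using h

theorem del_succ_stringDefect (k : ℕ) (α : ι) : del (k + 1, α) (stringDefect e F B φ) =
    del (k, α) F + formalSum (fun j : ℕ × ι => MvPowerSeries.X (j.1 + 1, j.2) *
      del j (del (k + 1, α) F)) - del (0, e) (del (k + 1, α) F) := by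
  have h := pderiv_formalSum_X_mul_apply shift_injective
    (fun j : ℕ × ι => MvPowerSeries.pderiv K j F) (k, α)
  have h' := del_succ_halfSquare B φ k α
  simp only [del] at h'
  simp only [del, stringDefect, map_sub, map_add, h', h, zero_add, pderiv_pderiv_comm (k + 1, α)]

theorem del_zero_stringDefect (α : ι) : del (0, α) (stringDefect e F B φ) =
    del (0, α) (halfSquare B φ) + formalSum (fun j : ℕ × ι => MvPowerSeries.X (j.1 + 1, j.2) *
      del j (del (0, α) F)) - del (0, e) (del (0, α) F) := by
  have h := pderiv_formalSum_X_mul_of_forall_ne (a := fun j : ℕ × ι => (j.1 + 1, j.2))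
    (i := (0, α)) (by simp) (fun j : ℕ × ι => MvPowerSeries.pderiv K j F)
  simp only [del, stringDefect, map_sub, map_add, h, pderiv_pderiv_comm (0, α)]

omit [Fintype ι] in
theorem finsum_shift {R : Type*} [CommRing R] {t q : ℕ × ι → R}
    (ht : IsNilpotentPoint t) (hq : ∀ j, j ≠ (1, e) → q j = t j)
    (hqe : q (1, e) = t (1, e) - 1) (c : ℕ × ι → R) :
    (∑ᶠ j : ℕ × ι, q (j.1 + 1, j.2) * c j) =
      (∑ᶠ j : ℕ × ι, t (j.1 + 1, j.2) * c j) - c (0, e) := by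
  classical
  rw [sub_eq_add_neg, ← finsum_eq_single (fun j => if j = (0, e) then -c j else 0) (0, e)
    (fun j hj => if_neg hj) |>.trans (if_pos rfl), ← finsum_add_distrib]
  · refine finsum_congr fun j => ?_
    split_ifs with hj
    · rw [hj, zero_add, hqe]
      ring
    · rw [hq, add_zero]
      contrapose! hj
      ext <;> simp_all
  · refine (ht.finite_support.preimage shift_injective.injOn).subset fun j hj h0 => hj ?_
    simp only [h0, zero_mul]
  · exact (Set.finite_singleton ((0, e) : ℕ × ι)).subset fun j hj => by
      by_contra h
      exact hj (if_neg h)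

theorem evalAt_del_succ_stringDefect {R : Type*} [CommRing R] [Algebra K R] {t q : ℕ × ι → R}
    (ht : IsNilpotentPoint t) (hq : ∀ j, j ≠ (1, e) → q j = t j)
    (hqe : q (1, e) = t (1, e) - 1) (k : ℕ) (α : ι) :
    evalAt (del (k + 1, α) (stringDefect e F B φ)) t =
      evalAt (del (k, α) F) t +
        ∑ᶠ j : ℕ × ι, q (j.1 + 1, j.2) * evalAt (del j (del (k + 1, α) F)) t := by
  rw [finsum_shift e ht hq hqe, del_succ_stringDefect, ← ht.evalHom_apply]
  simp only [map_sub, map_add]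
  simp only [ht.evalHom_apply]
  rw [ht.evalAt_formalSum_X_mul shift_injective, add_sub_assoc]

variable {B} in
theorem evalAt_del_zero_stringDefect [CharZero K] (hsymm : B.IsSymm) {R : Type*} [CommRing R]
    [Algebra K R] {t q : ℕ × ι → R}
    (ht : IsNilpotentPoint t) (hq : ∀ j, j ≠ (1, e) → q j = t j)
    (hqe : q (1, e) = t (1, e) - 1) (α : ι) :
    evalAt (del (0, α) (stringDefect e F B φ)) t =
      (∑ γ, q (0, γ) * algebraMap K R (B (φ γ) (φ α))) +
        ∑ᶠ j : ℕ × ι, q (j.1 + 1, j.2) * evalAt (del j (del (0, α) F)) t := by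
  rw [finsum_shift e ht hq hqe, del_zero_stringDefect, del_zero_halfSquare φ hsymm,
    ← ht.evalHom_apply]
  simp only [map_sub, map_add, map_sum, map_smul, ht.evalHom_X]
  simp only [ht.evalHom_apply]
  rw [ht.evalAt_formalSum_X_mul shift_injective, add_sub_assoc]
  congr 1
  refine Finset.sum_congr rfl fun γ _ => ?_
  rw [hq (0, γ) (by simp), Algebra.smul_def, mul_comm]

end Defects

/-! ### Tangent spaces: `f ∈ L`, `f ∈ zL`, `zL ⊆ L` -/

section Cone

variable {K : Type u} [Field K] {H : Type v} [AddCommGroup H] [Module K H]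
  {R : Type u} [CommRing R] [Algebra K R] {ι : Type w}
  {B : LinearMap.BilinForm K H} (φ : Module.Basis ι K H) (e : ι) {F : MvPowerSeries (ℕ × ι) K}

theorem finsum_nat_prod_eq_add_shift [Fintype ι] {M : Type*} [AddCommMonoid M] (a : ℕ × ι → M)
    (ha : Function.HasFiniteSupport a) :
    ∑ᶠ j, a j = ∑ γ, a (0, γ) + ∑ᶠ j : ℕ × ι, a (j.1 + 1, j.2) := by
  have hunion : (Set.univ : Set (ℕ × ι)) = Set.range (fun γ : ι => ((0, γ) : ℕ × ι)) ∪
      Set.range (fun j : ℕ × ι => (j.1 + 1, j.2)) := by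
    ext ⟨k, γ⟩
    simp only [Set.mem_univ, Set.mem_union, Set.mem_range, true_iff]
    rcases k with _ | k
    · exact Or.inl ⟨γ, rfl⟩
    · exact Or.inr ⟨(k, γ), rfl⟩
  have hdisj : Disjoint (Set.range (fun γ : ι => ((0, γ) : ℕ × ι)))
      (Set.range (fun j : ℕ × ι => (j.1 + 1, j.2))) := by
    rw [Set.disjoint_left]
    rintro n ⟨k, rfl⟩ ⟨l, hl⟩
    simp at hl
  rw [← finsum_mem_univ, hunion, finsum_mem_union' hdisj (Set.Finite.subset ha Set.inter_subset_right)
      (Set.Finite.subset ha Set.inter_subset_right), finsum_mem_range (fun a b h => by simpa using h),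
      finsum_mem_range shift_injective, finsum_eq_sum_of_fintype]

theorem qCoord_eq_tCoord (f : LoopSpace K H R) (j : ℕ × ι) (hj : j ≠ (1, e)) :
    qCoord φ f j = tCoord φ e f j := by
  simp [tCoord, hj]

theorem qCoord_dilaton (f : LoopSpace K H R) :
    qCoord φ f (1, e) = tCoord φ e f (1, e) - 1 := by
  simp [tCoord]

theorem isNilpotentPoint_tCoord [Finite ι] {f : LoopSpace K H R}
    (hf : ∀ i, IsNilpotent (tCoord φ e f i)) : IsNilpotentPoint (tCoord φ e f) where
  finite_support := by
    refine ((finite_support_qCoord φ f).union (Set.finite_singleton (1, e))).subset fun i hi => ?_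
    by_contra h
    rw [Set.mem_union, not_or] at h
    exact hi (by rw [← qCoord_eq_tCoord φ e f i h.2]; simpa using h.1)
  isNilpotent := hf

theorem finite_support_qCoord_smul [Finite ι] {M : Type*} [AddCommGroup M] [Module R M]
    (h : LoopSpace K H R) (c : ℕ × ι → M) :
    Function.HasFiniteSupport (fun j => qCoord φ h j • c j) :=
  (finite_support_qCoord φ h).subset fun j hj h0 => hj (by simp [h0])

theorem finite_support_qCoord_mul [Finite ι] (h : LoopSpace K H R) (c : ℕ × ι → R) :
    Function.HasFiniteSupport (fun j => qCoord φ h j * c j) :=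
  finite_support_qCoord_smul φ h c

theorem sub_mem_tangentSpace [Finite ι] {f h h' : LoopSpace K H R}
    (hh : h ∈ tangentSpace B φ e F f) (hh' : h' ∈ tangentSpace B φ e F f) :
    h - h' ∈ tangentSpace B φ e F f := by
  intro i
  rw [pCoord_sub, hh i, hh' i, ← finsum_sub_distrib (finite_support_qCoord_mul φ _ _)
    (finite_support_qCoord_mul φ _ _)]
  exact finsum_congr fun j => by rw [qCoord_sub, sub_mul]

theorem smul_mem_tangentSpace [Finite ι] {f h : LoopSpace K H R} (c : R)
    (hh : h ∈ tangentSpace B φ e F f) : c • h ∈ tangentSpace B φ e F f := by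
  intro i
  rw [pCoord_smul, hh i, mul_finsum' _ _ (finite_support_qCoord_mul φ _ _)]
  exact finsum_congr fun j => by rw [qCoord_smul, mul_assoc]

theorem exists_mulZ_eq (f : LoopSpace K H R) : ∃ h : LoopSpace K H R, mulZ h = f := by
  obtain ⟨N, hN⟩ := f.2
  refine ⟨⟨fun n => f.1 (n + 1), N, fun n hn => hN _ (by omega)⟩, Subtype.ext (funext fun n => ?_)⟩
  simp [mulZ]

theorem mulZ_injective : Function.Injective (mulZ : LoopSpace K H R → LoopSpace K H R) := by
  intro f g h
  refine Subtype.ext (funext fun n => ?_)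
  have := congrFun (congrArg Subtype.val h) (n + 1)
  simpa [mulZ] using this

theorem mulZ_sub (f g : LoopSpace K H R) : mulZ (f - g) = mulZ f - mulZ g := rfl

theorem mulZ_smul (c : R) (f : LoopSpace K H R) : mulZ (c • f) = c • mulZ f := rfl

theorem mem_tangentSpace_self_iff [Fintype ι] {f : LoopSpace K H R}
    (hf : f ∈ graphOfDifferential B φ e F R) :
    f ∈ tangentSpace B φ e F f ↔ ∀ i, evalAt (del i (dilatonDefect e F)) (tCoord φ e f) = 0 := by
  refine forall_congr' fun i => ?_
  rw [hf.2 i, evalAt_del_dilatonDefect e F (isNilpotentPoint_tCoord φ e hf.1)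
    (qCoord_eq_tCoord φ e f) (qCoord_dilaton φ e f), sub_eq_zero, eq_comm]

theorem pCoord_zero_eq [Fintype ι] (h : LoopSpace K H R) (α : ι) :
    pCoord B φ h (0, α) = -∑ γ, qCoord φ (mulZ h) (0, γ) * algebraMap K R (B (φ γ) (φ α)) := by
  rw [pCoord_apply, sum_repr_mul_gram]
  simp [qCoord, mulZ]

/-- If `f = zh`, the `q` of `h` is the shifted `q` of `f`, `p_{k+1}(h) = -p_k(f) = -∂_k F`, and
`p_0(h)` is minus the pairing with `q_0(f)`. The linearized equation for `h` is thus SE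
differentiated. -/
theorem mem_mulZ_tangentSpace_self_iff [Fintype ι] [CharZero K] (hsymm : B.IsSymm)
    {f : LoopSpace K H R} (hf : f ∈ graphOfDifferential B φ e F R) :
    f ∈ mulZ '' tangentSpace B φ e F f ↔
      ∀ i, evalAt (del i (stringDefect e F B φ)) (tCoord φ e f) = 0 := by
  obtain ⟨h, rfl⟩ := exists_mulZ_eq f
  have ht := isNilpotentPoint_tCoord φ e hf.1
  rw [mulZ_injective.mem_set_image]
  refine forall_congr' fun i => ?_
  have hq : ∀ c : ℕ × ι → R, ∑ᶠ j, qCoord φ h j * c j =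
      ∑ᶠ j : ℕ × ι, qCoord φ (mulZ h) (j.1 + 1, j.2) * c j := fun c =>
    finsum_congr fun j => by rw [qCoord_mulZ_succ]
  rw [hq]
  obtain ⟨k, α⟩ := i
  rcases k with _ | k
  · rw [evalAt_del_zero_stringDefect e F φ hsymm ht
      (qCoord_eq_tCoord φ e _) (qCoord_dilaton φ e _), pCoord_zero_eq, neg_eq_iff_add_eq_zero]
  · rw [evalAt_del_succ_stringDefect e F B φ ht
      (qCoord_eq_tCoord φ e _) (qCoord_dilaton φ e _), ← hf.2, pCoord_mulZ,
      neg_add_eq_zero]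

variable [Fintype ι] [DecidableEq ι]

theorem exists_mem_tangentSpace (hB : B.Nondegenerate) (f : LoopSpace K H R) (j : ℕ × ι) :
    ∃ h ∈ tangentSpace B φ e F f, qCoord φ h = Pi.single j 1 ∧
      ∀ i, pCoord B φ h i = evalAt (del j (del i F)) (tCoord φ e f) := by
  obtain ⟨h, hq, hp⟩ := exists_qCoord_pCoord R φ hB (Pi.single j 1)
    (fun i => evalAt (del j (del i F)) (tCoord φ e f))
    ((Set.finite_singleton j).subset Pi.support_single_subset)
  refine ⟨h, fun i => ?_, funext hq, hp⟩
  rw [hp, finsum_eq_single _ j fun l hl => by rw [hq, Pi.single_eq_of_ne hl, zero_mul], hq,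
    Pi.single_eq_same, one_mul]

theorem isLagrangianSet_tangentSpace (hsymm : B.IsSymm) (hB : B.Nondegenerate)
    (f : LoopSpace K H R) : IsLagrangianSet B (tangentSpace B φ e F f) := by
  intro h
  constructor
  · intro hh h' hh'
    have hfin := finite_support_qCoord φ h
    have hfin' := finite_support_qCoord φ h'
    set J := hfin.toFinset ∪ hfin'.toFinset with hJ
    have hs : ∀ c : ℕ × ι → R, ∑ᶠ j, qCoord φ h j * c j = ∑ j ∈ J, qCoord φ h j * c j := fun c =>
      finsum_eq_sum_of_support_subset _ fun j hj => by
        simp only [hJ, Finset.coe_union, Set.Finite.coe_toFinset]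
        exact Or.inl fun h0 => hj (by simp [h0])
    have hs' : ∀ c : ℕ × ι → R, ∑ᶠ j, qCoord φ h' j * c j = ∑ j ∈ J, qCoord φ h' j * c j :=
      fun c => finsum_eq_sum_of_support_subset _ fun j hj => by
        simp only [hJ, Finset.coe_union, Set.Finite.coe_toFinset]
        exact Or.inr fun h0 => hj (by simp [h0])
    have hcomm : ∀ i, pCoord B φ h i * qCoord φ h' i = qCoord φ h' i * pCoord B φ h i :=
      fun i => mul_comm _ _
    rw [Omega_eq_finsum B φ hsymm]
    simp_rw [hcomm]
    rw [finsum_sub_distrib (finite_support_qCoord_mul φ _ _) (finite_support_qCoord_mul φ _ _),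
      hs, hs', sub_eq_zero]
    simp_rw [hh _, hh' _, hs, hs', Finset.mul_sum]
    rw [Finset.sum_comm]
    refine Finset.sum_congr rfl fun i _ => Finset.sum_congr rfl fun j _ => ?_
    rw [del, del, pderiv_pderiv_comm]
    ring
  · intro hh i
    -- Orthogonality to the tangent vector over the `i`-th basis vector of `H[z]` is exactly the
    -- `i`-th linearized equation.
    obtain ⟨h', hh', hq, hp⟩ := exists_mem_tangentSpace φ e hB f i (F := F)
    have h0 := hh h' hh'
    rw [Omega_eq_finsum B φ hsymm, finsum_sub_distrib ?_ (finite_support_qCoord_mul φ _ _),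
      sub_eq_zero, finsum_eq_single _ i, hq, Pi.single_eq_same, mul_one] at h0
    · rw [h0]
      exact finsum_congr fun j => by rw [hp, del, del, pderiv_pderiv_comm]
    · intro j hj
      rw [hq, Pi.single_eq_of_ne hj, mul_zero]
    · exact (finite_support_qCoord φ h').subset fun j hj h0 => hj (by simp [h0])

/-- Derivatives along `zh` are expressed by the coordinates of `h`: the part `q_0(zh)` is given by
`p_0(h)`, which the Hessian determines. The operators that appear are the ones that TRR makes vanish
on second derivatives of `F` at `f`. The module `M` is `R` for the invariance of `L` and `R[X]` for
motion along a line. -/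
theorem finsum_qCoord_mulZ (hB : B.Nondegenerate) {f h : LoopSpace K H R}
    (hh : h ∈ tangentSpace B φ e F f) {M : Type*} [AddCommGroup M] [Module R M]
    (c : ℕ × ι → M) :
    ∑ᶠ j, qCoord φ (mulZ h) j • c j =
      ∑ᶠ j : ℕ × ι, qCoord φ h j • (c (j.1 + 1, j.2) - ∑ γ, ∑ μ,
        (algebraMap K R (gramInv B φ μ γ) * evalAt (del j (del (0, μ) F)) (tCoord φ e f)) •
          c (0, γ)) := by
  set J := (finite_support_qCoord φ h).toFinset with hJ
  have hs : ∀ c : ℕ × ι → M, ∑ᶠ j, qCoord φ h j • c j = ∑ j ∈ J, qCoord φ h j • c j := fun c =>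
    finsum_eq_sum_of_support_subset _ fun j hj => by
      simp only [hJ, Set.Finite.coe_toFinset]
      exact fun h0 => hj (by simp [h0])
  have hs' : ∀ c : ℕ × ι → R, ∑ᶠ j, qCoord φ h j * c j = ∑ j ∈ J, qCoord φ h j * c j := fun c =>
    finsum_eq_sum_of_support_subset _ fun j hj => by
      simp only [hJ, Set.Finite.coe_toFinset]
      exact fun h0 => hj (by simp [h0])
  rw [finsum_nat_prod_eq_add_shift _ (finite_support_qCoord_smul φ _ _)]
  simp only [qCoord_mulZ_succ, qCoord_mulZ_zero φ hB, hh _]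
  rw [hs fun j => c (j.1 + 1, j.2), hs]
  simp only [hs', smul_sub, Finset.sum_sub_distrib, neg_smul, Finset.sum_neg_distrib]
  rw [neg_add_eq_sub]
  congr 1
  simp only [Finset.smul_sum, Finset.sum_smul, Finset.mul_sum, smul_smul]
  rw [Finset.sum_comm (s := J)]
  refine Finset.sum_congr rfl fun γ _ => ?_
  rw [Finset.sum_comm (s := J)]
  refine Finset.sum_congr rfl fun μ _ => Finset.sum_congr rfl fun j _ => ?_
  rw [mul_left_comm]

/-- The relation between second derivatives, at a point, that makes the tangent space invariant
under multiplication by `z`. -/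
def TwoPointRelation (B : LinearMap.BilinForm K H) (F : MvPowerSeries (ℕ × ι) K) (t : ℕ × ι → R)
    (i j : ℕ × ι) : Prop :=
  evalAt (del j (del (i.1 + 1, i.2) F)) t + evalAt (del (j.1 + 1, j.2) (del i F)) t =
    ∑ γ, ∑ μ, algebraMap K R (gramInv B φ μ γ) * evalAt (del j (del (0, μ) F)) t *
      evalAt (del (0, γ) (del i F)) t

theorem mulZ_tangentSpace_subset_iff (hB : B.Nondegenerate) (f : LoopSpace K H R) :
    mulZ '' tangentSpace B φ e F f ⊆ tangentSpace B φ e F f ↔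
      ∀ i j, TwoPointRelation φ B F (tCoord φ e f) i j := by
  have key : ∀ h ∈ tangentSpace B φ e F f, ∀ i, (pCoord B φ (mulZ h) i =
      ∑ᶠ j, qCoord φ (mulZ h) j * evalAt (del j (del i F)) (tCoord φ e f)) ↔
      ∑ᶠ j : ℕ × ι, qCoord φ h j * (evalAt (del j (del (i.1 + 1, i.2) F)) (tCoord φ e f) +
        evalAt (del (j.1 + 1, j.2) (del i F)) (tCoord φ e f) -
        ∑ γ, ∑ μ, algebraMap K R (gramInv B φ μ γ) *
          evalAt (del j (del (0, μ) F)) (tCoord φ e f) *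
            evalAt (del (0, γ) (del i F)) (tCoord φ e f)) = 0 := fun h hh i => by
    have h1 := finsum_qCoord_mulZ φ e hB hh
      fun j => evalAt (del j (del i F)) (tCoord φ e f)
    simp only [smul_eq_mul] at h1
    obtain ⟨k, α⟩ := i
    rw [h1, pCoord_mulZ, hh, neg_eq_iff_add_eq_zero, ← finsum_add_distrib
      (finite_support_qCoord_mul φ _ _) (finite_support_qCoord_mul φ _ _)]
    simp only [← mul_add, add_sub_assoc]
  constructor
  · intro hz i j
    obtain ⟨h, hh, hq, -⟩ := exists_mem_tangentSpace φ e hB f j (F := F)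
    have h1 := (key h hh i).mp (hz ⟨h, hh, rfl⟩ i)
    rw [finsum_eq_single _ j fun l hl => by rw [hq, Pi.single_eq_of_ne hl, zero_mul], hq,
      Pi.single_eq_same, one_mul] at h1
    exact sub_eq_zero.mp h1
  · rintro hrel _ ⟨h, hh, rfl⟩ i
    refine (key h hh i).mpr ((finsum_congr fun j => ?_).trans finsum_zero)
    rw [sub_eq_zero.mpr (hrel i j), mul_zero]

end Cone

/-! ### The two-point relation and the recursion -/

section Recursion

variable {K : Type u} [Field K] {ι : Type*} [Fintype ι] [DecidableEq ι]
  {H : Type*} [AddCommGroup H] [Module K H] (B : LinearMap.BilinForm K H)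
  (φ : Module.Basis ι K H) (e : ι) (F : MvPowerSeries (ℕ × ι) K)

/-- The difference of the two sides of a topological recursion relation. -/
noncomputable def recursionDefect (i j m : ℕ × ι) : MvPowerSeries (ℕ × ι) K :=
  del (i.1 + 1, i.2) (del j (del m F)) -
    ∑ μ, ∑ ν, gramInv B φ μ ν • (del i (del (0, μ) F) * del (0, ν) (del j (del m F)))

theorem topologicalRecursionRelations_iff :
    TopologicalRecursionRelations B φ F ↔ ∀ i j m, recursionDefect B φ F i j m = 0 := by
  constructor
  · intro h i j m
    exact sub_eq_zero.mpr (h i.2 j.2 m.2 i.1 j.1 m.1)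
  · intro h α β γ k l m
    exact sub_eq_zero.mp (h (k, α) (l, β) (m, γ))

theorem recursionDefect_comm (i j m : ℕ × ι) :
    recursionDefect B φ F i j m = recursionDefect B φ F i m j := by
  simp only [recursionDefect, del, pderiv_pderiv_comm j m]

/-- The difference of the two sides of the relation between second derivatives that makes the
tangent spaces invariant under multiplication by `z`. -/
noncomputable def twoPointDefect (i j : ℕ × ι) : MvPowerSeries (ℕ × ι) K :=
  del j (del (i.1 + 1, i.2) F) + del (j.1 + 1, j.2) (del i F) -
    ∑ γ, ∑ μ, gramInv B φ μ γ • (del j (del (0, μ) F) * del (0, γ) (del i F))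

theorem twoPointRelation_iff {R : Type u} [CommRing R] [Algebra K R] {t : ℕ × ι → R}
    (ht : IsNilpotentPoint t) (i j : ℕ × ι) :
    TwoPointRelation φ B F t i j ↔ evalAt (twoPointDefect B φ F i j) t = 0 := by
  rw [twoPointDefect, ← ht.evalHom_apply]
  simp only [map_sub, map_add, map_sum, map_smul, map_mul]
  simp only [ht.evalHom_apply, sub_eq_zero, Algebra.smul_def, TwoPointRelation, mul_assoc]

variable {B}

/-- By Leibniz, each linear term pairs with the product in which the other factor is left
undifferentiated. -/
theorem del_twoPointDefect (hsymm : B.IsSymm) (i j m : ℕ × ι) :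
    del m (twoPointDefect B φ F i j) =
      recursionDefect B φ F i j m + recursionDefect B φ F j i m := by
  have c1 : ∀ a b c, MvPowerSeries.pderiv K a (MvPowerSeries.pderiv K b
      (MvPowerSeries.pderiv K c F)) = MvPowerSeries.pderiv K c (MvPowerSeries.pderiv K b
        (MvPowerSeries.pderiv K a F)) := fun a b c => by
    rw [pderiv_pderiv_comm b c, pderiv_pderiv_comm a c, pderiv_pderiv_comm a b]
  have c2 : ∀ a b c, MvPowerSeries.pderiv K a (MvPowerSeries.pderiv K b
      (MvPowerSeries.pderiv K c F)) = MvPowerSeries.pderiv K b (MvPowerSeries.pderiv K c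
        (MvPowerSeries.pderiv K a F)) := fun a b c => by
    rw [pderiv_pderiv_comm a b, pderiv_pderiv_comm a c]
  have e1 : ∑ γ, ∑ μ, gramInv B φ μ γ •
      (MvPowerSeries.pderiv K j (MvPowerSeries.pderiv K (0, μ) F) *
        MvPowerSeries.pderiv K m (MvPowerSeries.pderiv K (0, γ) (MvPowerSeries.pderiv K i F))) =
      ∑ μ, ∑ ν, gramInv B φ μ ν • (MvPowerSeries.pderiv K j (MvPowerSeries.pderiv K (0, μ) F) *
        MvPowerSeries.pderiv K (0, ν) (MvPowerSeries.pderiv K i (MvPowerSeries.pderiv K m F))) := by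
    rw [Finset.sum_comm]
    refine Finset.sum_congr rfl fun μ _ => Finset.sum_congr rfl fun ν _ => ?_
    rw [c2 m]
  have e2 : ∑ γ, ∑ μ, gramInv B φ μ γ •
      (MvPowerSeries.pderiv K (0, γ) (MvPowerSeries.pderiv K i F) *
        MvPowerSeries.pderiv K m (MvPowerSeries.pderiv K j (MvPowerSeries.pderiv K (0, μ) F))) =
      ∑ μ, ∑ ν, gramInv B φ μ ν • (MvPowerSeries.pderiv K i (MvPowerSeries.pderiv K (0, μ) F) *
        MvPowerSeries.pderiv K (0, ν) (MvPowerSeries.pderiv K j (MvPowerSeries.pderiv K m F))) := by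
    refine Finset.sum_congr rfl fun μ _ => Finset.sum_congr rfl fun ν _ => ?_
    rw [c1 m, gramInv_symm φ hsymm, pderiv_pderiv_comm i]
  simp only [twoPointDefect, recursionDefect, del, map_sub, map_add, map_sum, Derivation.map_smul,
    Derivation.leibniz, smul_eq_mul, smul_add, Finset.sum_add_distrib]
  rw [e1, e2, c1 m j, c2 m (j.1 + 1, j.2)]
  ring

theorem recursionDefect_eq_zero [CharZero K] (hsymm : B.IsSymm)
    (h : ∀ i j, twoPointDefect B φ F i j = 0) (i j m : ℕ × ι) :
    recursionDefect B φ F i j m = 0 := by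
  have hanti : ∀ i j m, recursionDefect B φ F i j m = -recursionDefect B φ F j i m :=
    fun i j m => by
      rw [← add_eq_zero_iff_eq_neg, ← del_twoPointDefect φ F hsymm, h, del, map_zero]
  -- A transposition of the first two indices costs a sign, one of the last two does not. Three of
  -- the former, interleaved with three of the latter, return to the start with sign `-1`.
  have hself : recursionDefect B φ F i j m = -recursionDefect B φ F i j m := by
    conv_lhs => rw [hanti i j m, recursionDefect_comm, hanti j m i, neg_neg, recursionDefect_comm,
      hanti m i j, recursionDefect_comm]
  ext n
  have := congrArg (MvPowerSeries.coeff n) hself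
  rw [map_neg] at this
  rw [map_zero]
  exact CharZero.eq_neg_self_iff.mp this

omit [DecidableEq ι] in
theorem constantCoeff_del_succ_del_succ_stringDefect (k l : ℕ) (α γ : ι) :
    MvPowerSeries.constantCoeff (del (k + 1, α) (del (l + 1, γ) (stringDefect e F B φ))) =
      MvPowerSeries.constantCoeff (del (k + 1, α) (del (l, γ) F)) +
        MvPowerSeries.constantCoeff (del (k, α) (del (l + 1, γ) F)) -
          MvPowerSeries.constantCoeff (del (k + 1, α) (del (0, e) (del (l + 1, γ) F))) := by
  have h := pderiv_formalSum_X_mul_apply shift_injective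
    (fun j : ℕ × ι => del j (del (l + 1, γ) F)) (k, α)
  rw [del_succ_stringDefect, del, map_sub, map_add, h, map_sub, map_add, map_add,
    constantCoeff_formalSum_X_mul, add_zero]

omit [DecidableEq ι] in
theorem constantCoeff_del_zero_del_succ_stringDefect (l : ℕ) (α γ : ι) :
    MvPowerSeries.constantCoeff (del (0, α) (del (l + 1, γ) (stringDefect e F B φ))) =
      MvPowerSeries.constantCoeff (del (0, α) (del (l, γ) F)) -
          MvPowerSeries.constantCoeff (del (0, α) (del (0, e) (del (l + 1, γ) F))) := by
  have h := pderiv_formalSum_X_mul_of_forall_ne (a := fun j : ℕ × ι => (j.1 + 1, j.2))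
    (i := (0, α)) (by simp) (fun j : ℕ × ι => del j (del (l + 1, γ) F))
  rw [del_succ_stringDefect, del, map_sub, map_add, h, map_sub, map_add,
    constantCoeff_formalSum_X_mul, add_zero]

theorem twoPointDefect_eq_zero [CharZero K] (hsymm : B.IsSymm)
    (htrr : ∀ i j m, recursionDefect B φ F i j m = 0) (hs : stringDefect e F B φ = 0)
    (i j : ℕ × ι) : twoPointDefect B φ F i j = 0 := by
  refine MvPowerSeries.pderiv.ext (fun m => ?_) ?_
  · rw [map_zero]
    exact (del_twoPointDefect φ F hsymm i j m).trans (by rw [htrr, htrr, add_zero])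
  · obtain ⟨k, α⟩ := i
    obtain ⟨l, γ⟩ := j
    have h1 := constantCoeff_del_succ_del_succ_stringDefect (B := B) φ e F k l α γ
    have h2 := fun ν => constantCoeff_del_zero_del_succ_stringDefect (B := B) φ e F l ν γ
    -- At the origin SE trades `∂_{0,e} ∂_{l+1,γ}` for `∂_{l,γ}` after applying `∂_{0,ν}` (`h2`),
    -- and produces both linear terms after applying `∂_{k+1,α}` (`h1`); this instance of TRR links
    -- the two.
    have h3 := congrArg MvPowerSeries.constantCoeff (htrr (k, α) (0, e) (l + 1, γ))
    rw [hs, del, del, map_zero, map_zero, map_zero] at h1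
    simp only [hs, del, map_zero] at h2
    simp only [recursionDefect, map_sub, map_sum, MvPowerSeries.constantCoeff_smul, map_mul,
      map_zero] at h3
    simp only [twoPointDefect, map_sub, map_add, map_sum, MvPowerSeries.constantCoeff_smul, map_mul,
      map_zero]
    have h4 : ∀ ν, MvPowerSeries.constantCoeff (MvPowerSeries.pderiv K (0, ν)
        (MvPowerSeries.pderiv K (0, e) (MvPowerSeries.pderiv K (l + 1, γ) F))) =
        MvPowerSeries.constantCoeff (MvPowerSeries.pderiv K (0, ν)
          (MvPowerSeries.pderiv K (l, γ) F)) := fun ν => (sub_eq_zero.mp (h2 ν).symm).symm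
    simp only [del, h4] at h3 h1 ⊢
    rw [pderiv_pderiv_comm (l, γ), pderiv_pderiv_comm (l + 1, γ)]
    have h5 : ∑ x, ∑ y, gramInv B φ y x • (MvPowerSeries.constantCoeff (MvPowerSeries.pderiv K (l, γ)
        (MvPowerSeries.pderiv K (0, y) F)) * MvPowerSeries.constantCoeff
          (MvPowerSeries.pderiv K (0, x) (MvPowerSeries.pderiv K (k, α) F))) =
        ∑ x, ∑ y, gramInv B φ x y • (MvPowerSeries.constantCoeff (MvPowerSeries.pderiv K (k, α)
          (MvPowerSeries.pderiv K (0, x) F)) * MvPowerSeries.constantCoeff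
            (MvPowerSeries.pderiv K (0, y) (MvPowerSeries.pderiv K (l, γ) F))) := by
      refine Finset.sum_congr rfl fun x _ => Finset.sum_congr rfl fun y _ => ?_
      rw [gramInv_symm φ hsymm, pderiv_pderiv_comm (l, γ), pderiv_pderiv_comm (k, α), mul_comm]
    rw [h5]
    linear_combination h3 - h1

end Recursion

/-! ### The Hessian of `F` is constant along `zL` -/

section Constancy
open Polynomial

variable {K : Type u} [Field K] [CharZero K] {H : Type v} [AddCommGroup H] [Module K H]
  {R : Type u} [CommRing R] [Algebra K R] {ι : Type w} [Fintype ι] [DecidableEq ι]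
  {B : LinearMap.BilinForm K H} (φ : Module.Basis ι K H) (e : ι) {F : MvPowerSeries (ℕ × ι) K}

/-- The second derivatives are constant along `z L`, where `L` is a tangent space. -/
theorem evalAt_eq_of_add_mulZ (hB : B.Nondegenerate)
    (htrr : ∀ i j m, recursionDefect B φ F i j m = 0) {f h : LoopSpace K H R}
    (hf : f ∈ graphOfDifferential B φ e F R) (hh : h ∈ tangentSpace B φ e F f)
    (hz : mulZ h ∈ tangentSpace B φ e F f)
    (hg : ∀ i, IsNilpotent (tCoord φ e (f + mulZ h) i)) :
    (∀ i, evalAt (del i F) (tCoord φ e (f + mulZ h)) = pCoord B φ (f + mulZ h) i) ∧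
      ∀ i j, evalAt (del j (del i F)) (tCoord φ e (f + mulZ h)) =
        evalAt (del j (del i F)) (tCoord φ e f) := by
  set t := tCoord φ e f with ht_def
  have ht : IsNilpotentPoint t := isNilpotentPoint_tCoord φ e hf.1
  let v : ℕ × ι → R := qCoord φ (mulZ h)
  -- The line from `f` to `f + zh`, as a nilpotent point over `R[X]`; its values at `X = 0` and `X =
  -- 1` are the two endpoints.
  let T : ℕ × ι → R[X] := fun i => C (t i) + X * C (v i)
  have hv : ∀ i, tCoord φ e (f + mulZ h) i = t i + v i := fun i => by
    simp only [tCoord, qCoord_add, ht_def, v]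
    ring
  have hvnil : ∀ i, IsNilpotent (v i) := fun i => by
    have h1 := (Commute.all _ _).isNilpotent_sub (hg i) (ht.isNilpotent i)
    rwa [hv, add_sub_cancel_left] at h1
  have hT : IsNilpotentPoint T := by
    refine ⟨(ht.finite_support.union (finite_support_qCoord φ (mulZ h))).subset fun i hi => ?_,
      fun i => ?_⟩
    · by_contra hc
      rw [Set.mem_union, not_or, Function.notMem_support, Function.notMem_support] at hc
      exact hi (by simp [T, v, hc.1, hc.2])
    · exact (Commute.all _ _).isNilpotent_add ((ht.isNilpotent i).map C)
        ((Commute.all _ _).isNilpotent_mul_left ((hvnil i).map C))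
  have hev : ∀ (a : R) (G : MvPowerSeries (ℕ × ι) K),
      (evalAt G T).eval a = evalAt G fun i => t i + a * v i := fun a G => by
    have h1 := hT.evalAt_map ((aeval (R := R) a).restrictScalars K) G
    simp only [AlgHom.coe_restrictScalars', coe_aeval_eq_eval, T, eval_add, eval_C, eval_mul,
      eval_X] at h1
    exact h1.symm
  have hev0 : ∀ G : MvPowerSeries (ℕ × ι) K, (evalAt G T).coeff 0 = evalAt G t := fun G => by
    rw [coeff_zero_eq_eval_zero, hev]
    simp
  have hev1 : ∀ G : MvPowerSeries (ℕ × ι) K,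
      evalAt G (tCoord φ e (f + mulZ h)) = (evalAt G T).eval 1 := fun G => by
    rw [hev]
    congr 1
    funext i
    rw [hv, one_mul]
  have hder : ∀ G : MvPowerSeries (ℕ × ι) K,
      derivative (evalAt G T) = ∑ᶠ j, v j • evalAt (del j G) T := fun G => by
    refine (hT.derivation_evalAt ((derivative' (R := R)).restrictScalars K) G).trans
      (finsum_congr fun j => ?_)
    have : derivative (T j) = C (v j) := by simp [T]
    rw [smul_eq_C_mul, ← this]
    rfl
  let W : (ℕ × ι) × (ℕ × ι) → R[X] := fun ij =>
    evalAt (del ij.2 (del ij.1 F)) T - C (evalAt (del ij.2 (del ij.1 F)) t)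
  have hW : ∀ ij, W ij = 0 := by
    refine eq_zero_of_derivative_dvd (K := K) W (fun ij => ?_) fun n hn ij => ?_
    · rw [coeff_sub, hev0, coeff_C_zero, sub_self]
    · rw [derivative_sub, derivative_C, sub_zero, hder, finsum_qCoord_mulZ φ e hB hh]
      refine finsum_induction (X ^ n ∣ ·) (dvd_zero _) (fun _ _ => dvd_add) fun j => ?_
      rw [smul_eq_C_mul]
      refine Dvd.dvd.mul_left ?_ _
      -- TRR has the Hessian at the moving point `T`, the direction `zh` has it at `t`. The
      -- difference is an entry of `W`, so `W` solves a homogeneous linear system with initial value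
      -- zero.
      have h1 := congrArg (hT.evalHom K) (htrr j ij.2 ij.1)
      simp only [recursionDefect, map_sub, map_sum, map_smul, map_mul, map_zero] at h1
      simp only [hT.evalHom_apply] at h1
      rw [sub_eq_zero.mp h1, Finset.sum_comm, ← Finset.sum_sub_distrib]
      refine Finset.dvd_sum fun γ _ => ?_
      rw [← Finset.sum_sub_distrib]
      refine Finset.dvd_sum fun μ _ => ?_
      have h2 : gramInv B φ μ γ • (evalAt (del j (del (0, μ) F)) T *
          evalAt (del (0, γ) (del ij.2 (del ij.1 F))) T) -
          (algebraMap K R (gramInv B φ μ γ) * evalAt (del j (del (0, μ) F)) t) •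
            evalAt (del (0, γ) (del ij.2 (del ij.1 F))) T =
          W ((0, μ), j) * (gramInv B φ μ γ • evalAt (del (0, γ) (del ij.2 (del ij.1 F))) T) := by
        simp only [W]
        rw [smul_eq_C_mul, C_mul, Algebra.smul_def, Algebra.smul_def,
          Polynomial.algebraMap_apply]
        ring
      rw [h2]
      exact (hn _).mul_right _
  have hconst : ∀ i j, evalAt (del j (del i F)) T = C (evalAt (del j (del i F)) t) :=
    fun i j => sub_eq_zero.mp (hW (i, j))
  refine ⟨fun i => ?_, fun i j => by rw [hev1, hconst, eval_C]⟩
  -- With a constant Hessian the first derivatives are affine in `X`; the slope is `p(zh)` because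
  -- `zh` is itself tangent.
  let P : Unit → R[X] := fun _ =>
    evalAt (del i F) T - C (evalAt (del i F) t) - C (pCoord B φ (mulZ h) i) * X
  have hP : P () = 0 := by
    refine eq_zero_of_derivative_dvd (K := K) P (fun _ => ?_) (fun n _ _ => ?_) ()
    · simp [P, hev0]
    · have h1 : derivative (P ()) = 0 := by
        have h2 : ∀ j, v j • (C (evalAt (del j (del i F)) t) : R[X]) =
            C (v j * evalAt (del j (del i F)) t) := fun j => by rw [smul_eq_C_mul, C_mul]
        simp only [P, derivative_sub, derivative_C, sub_zero, derivative_C_mul, derivative_X,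
          mul_one, hder, hconst, h2]
        have h3 := (C : R →+* R[X]).toAddMonoidHom.map_finsum
          (finite_support_qCoord_mul φ (mulZ h) fun j => evalAt (del j (del i F)) t)
        rw [hz i, sub_eq_zero]
        exact h3.symm
      exact h1 ▸ dvd_zero _
  have h4 : evalAt (del i F) T = C (evalAt (del i F) t) + C (pCoord B φ (mulZ h) i) * X := by
    simp only [P] at hP
    rw [← sub_eq_zero, ← hP]
    ring
  rw [hev1, h4, pCoord_add, hf.2 i]
  simp [ht_def]

end Constancy

/-! ### The two implications -/

section Main

variable {K : Type u} [Field K] [CharZero K] {H : Type v} [AddCommGroup H] [Module K H]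
  {ι : Type w} [Fintype ι] [DecidableEq ι]
  {B : LinearMap.BilinForm K H} (φ : Module.Basis ι K H) (e : ι) {F : MvPowerSeries (ℕ × ι) K}

omit [CharZero K] in
theorem exists_mem_graphOfDifferential {R : Type u} [CommRing R] [Algebra K R]
    (hB : B.Nondegenerate) {t : ℕ × ι → R} (ht : IsNilpotentPoint t) :
    ∃ f ∈ graphOfDifferential B φ e F R, tCoord φ e f = t := by
  obtain ⟨f, hq, hp⟩ := exists_qCoord_pCoord R φ hB (fun i => t i - if i = (1, e) then 1 else 0)
    (fun i => evalAt (del i F) t)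
    ((ht.finite_support.union (Set.finite_singleton (1, e))).subset fun i hi => by
      by_contra h
      rw [Set.mem_union, not_or, Function.notMem_support, Set.mem_singleton_iff] at h
      exact hi (by simp [h.1, h.2]))
  have hft : tCoord φ e f = t := funext fun i => by
    rw [tCoord, hq]
    split_ifs <;> simp
  refine ⟨f, ⟨fun i => ?_, fun i => ?_⟩, hft⟩
  · rw [hft]
    exact ht.isNilpotent i
  · rw [hft, hp]

omit [CharZero K] [DecidableEq ι] in
theorem graphOfDifferential_subset_formalNeighborhood {R : Type u} [CommRing R] [Algebra K R] :
    graphOfDifferential B φ e F R ⊆ formalNeighborhood B φ e F R := fun f hf =>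
  ⟨hf.1, fun i => by
    rw [hf.2 i]
    exact (isNilpotentPoint_tCoord φ e hf.1).isNilpotent_evalAt_sub _⟩

theorem lagrangianConeProperty_of_equations (hsymm : B.IsSymm) (hB : B.Nondegenerate)
    (htrr : ∀ i j m, recursionDefect B φ F i j m = 0) (hs : stringDefect e F B φ = 0) :
    LagrangianConeProperty B φ e F := by
  intro R _ _
  have hself : ∀ f ∈ graphOfDifferential B φ e F R, f ∈ mulZ '' tangentSpace B φ e F f :=
    fun f hf => by
      rw [mem_mulZ_tangentSpace_self_iff φ e hsymm hf]
      intro i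
      rw [hs, del, map_zero, ← (isNilpotentPoint_tCoord φ e hf.1).evalHom_apply, map_zero]
  intro f hf
  have hz : mulZ '' tangentSpace B φ e F f ⊆ tangentSpace B φ e F f := by
    rw [mulZ_tangentSpace_subset_iff φ e hB]
    intro i j
    have ht := isNilpotentPoint_tCoord φ e hf.1
    rw [twoPointRelation_iff B φ F ht, twoPointDefect_eq_zero φ e F hsymm htrr hs,
      ← ht.evalHom_apply, map_zero]
  have hnear : ∀ g, (∀ i, IsNilpotent (tCoord φ e g i)) → g ∈ mulZ '' tangentSpace B φ e F f →
      g ∈ graphOfDifferential B φ e F R ∧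
        tangentSpace B φ e F g = tangentSpace B φ e F f := by
    intro g hg hgz
    obtain ⟨h, hh, rfl⟩ := hgz
    obtain ⟨h', hh', hf'⟩ := hself f hf
    have hd := sub_mem_tangentSpace φ e hh hh'
    -- Both `f` and `g` lie in `zL`, so `g` is reached from `f` by a step in `zL`.
    have hgf : f + mulZ (h - h') = mulZ h := by
      rw [mulZ_sub, hf']
      exact add_sub_cancel f (mulZ h)
    obtain ⟨hp, hpp⟩ := evalAt_eq_of_add_mulZ φ e hB htrr hf hd (hz ⟨_, hd, rfl⟩) (by rwa [hgf])
    rw [hgf] at hp hpp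
    refine ⟨⟨hg, fun i => (hp i).symm⟩, ?_⟩
    ext x
    refine forall_congr' fun i => ?_
    simp only [hpp]
  refine ⟨isLagrangianSet_tangentSpace φ e hsymm hB f, fun c hc => ?_, hz, fun g hg =>
    ⟨hnear g hg.1, fun h => ?_⟩⟩
  · obtain ⟨h, hh, hhf⟩ := hself f hf
    refine (hnear (c • f) (fun i => ?_)
      ⟨c • h, smul_mem_tangentSpace φ e c hh, by rw [mulZ_smul, hhf]⟩).1
    have h1 : tCoord φ e (c • f) i = tCoord φ e f i + (c - 1) * qCoord φ f i := by
      rw [tCoord, tCoord, qCoord_smul]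
      ring
    rw [h1]
    exact (Commute.all _ _).isNilpotent_add (hf.1 i) ((Commute.all _ _).isNilpotent_mul_right hc)
  · rw [← h.2]
    exact hself g h.1

theorem equations_of_lagrangianConeProperty (hsymm : B.IsSymm) (hB : B.Nondegenerate)
    (hL : LagrangianConeProperty B φ e F) (hc : ConstantNormalized e F) :
    (∀ i j m, recursionDefect B φ F i j m = 0) ∧ stringDefect e F B φ = 0 ∧
      dilatonDefect e F = 0 := by
  have hz : ∀ (R : Type u) [CommRing R] [Algebra K R], ∀ f ∈ graphOfDifferential B φ e F R,
      f ∈ mulZ '' tangentSpace B φ e F f := fun R _ _ f hf =>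
    ((hL R f hf).2.2.2 f (graphOfDifferential_subset_formalNeighborhood φ e hf)).mpr ⟨hf, rfl⟩
  have hstr : ∀ i, del i (stringDefect e F B φ) = 0 := fun i => by
    refine eq_zero_of_forall_evalAt_eq_zero _ fun R _ _ t ht => ?_
    obtain ⟨f, hf, rfl⟩ := exists_mem_graphOfDifferential φ e hB ht (F := F)
    exact (mem_mulZ_tangentSpace_self_iff φ e hsymm hf).mp (hz R f hf) i
  have hdil : ∀ i, del i (dilatonDefect e F) = 0 := fun i => by
    refine eq_zero_of_forall_evalAt_eq_zero _ fun R _ _ t ht => ?_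
    obtain ⟨f, hf, rfl⟩ := exists_mem_graphOfDifferential φ e hB ht (F := F)
    exact (mem_tangentSpace_self_iff φ e hf).mp ((hL R f hf).2.2.1 (hz R f hf)) i
  have htwo : ∀ i j, twoPointDefect B φ F i j = 0 := fun i j => by
    refine eq_zero_of_forall_evalAt_eq_zero _ fun R _ _ t ht => ?_
    obtain ⟨f, hf, rfl⟩ := exists_mem_graphOfDifferential φ e hB ht (F := F)
    rw [← twoPointRelation_iff B φ F ht]
    exact (mulZ_tangentSpace_subset_iff φ e hB f).mp (hL R f hf).2.2.1 i j
  refine ⟨recursionDefect_eq_zero φ F hsymm htwo, MvPowerSeries.pderiv.ext (fun i => ?_) ?_,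
    MvPowerSeries.pderiv.ext (fun i => ?_) ?_⟩
  · exact (hstr i).trans (map_zero _).symm
  · rw [constantCoeff_stringDefect, map_zero, neg_eq_zero]
    -- At the origin SE gives `∂_{1,0} F = ∂_{1,0} ∂_{1,1} F` and DE gives `-∂_{1,0} F = ∂_{1,0}
    -- ∂_{1,1} F`; hence `2 ∂_{1,0} F = 0`.
    have h1 := congrArg MvPowerSeries.constantCoeff (hstr (0 + 1, e))
    have h2 := congrArg MvPowerSeries.constantCoeff (hdil (0, e))
    rw [del_succ_stringDefect, map_sub, map_add, constantCoeff_formalSum_X_mul, map_zero] at h1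
    rw [del_dilatonDefect, map_sub, map_sub, map_add,
      constantCoeff_formalSum_X_mul (fun j : ℕ × ι => j), map_zero,
      MvPowerSeries.constantCoeff_smul, smul_eq_mul, del, del, pderiv_pderiv_comm (1, e)] at h2
    simp only [del, zero_add] at h1 h2 ⊢
    have h3 : (2 : K) * MvPowerSeries.constantCoeff (MvPowerSeries.pderiv K (0, e) F) = 0 := by
      linear_combination h1 - h2
    exact (mul_eq_zero.mp h3).resolve_left two_ne_zero
  · exact (hdil i).trans (map_zero _).symm
  · rw [constantCoeff_dilatonDefect, map_zero, hc]
    ring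

end Main

end GenusZero

theorem theorem1 {K : Type*} [Field K] [CharZero K]
    {H : Type*} [AddCommGroup H] [Module K H]
    (B : LinearMap.BilinForm K H) (hsymm : B.IsSymm) (hnondeg : B.Nondegenerate)
    (one : H) (hone : one ≠ 0)
    {ι : Type*} [Fintype ι] [DecidableEq ι] (φ : Module.Basis ι K H) (e : ι) (he : φ e = one)
    (F : MvPowerSeries (ℕ × ι) K) :
    (GenusZero.TopologicalRecursionRelations B φ F ∧
      GenusZero.StringEquation B φ e F ∧
      GenusZero.DilatonEquation e F) ↔
    (GenusZero.LagrangianConeProperty B φ e F ∧ GenusZero.ConstantNormalized e F) := by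
  rw [GenusZero.topologicalRecursionRelations_iff, GenusZero.stringEquation_iff,
    GenusZero.dilatonEquation_iff]
  constructor
  · rintro ⟨htrr, hs, hd⟩
    refine ⟨GenusZero.lagrangianConeProperty_of_equations φ e hsymm hnondeg htrr hs, ?_⟩
    have h := GenusZero.constantCoeff_dilatonDefect e F
    rw [hd, map_zero] at h
    rw [GenusZero.ConstantNormalized]
    linear_combination h
  · rintro ⟨hL, hc⟩
    exact GenusZero.equations_of_lagrangianConeProperty φ e hsymm hnondeg hL hc
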